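/- Let $\mathbb H=\{(x,y): y>0\}$ be the hyperbolic plane with metric $(dx^2+dy^2)/y^2$. Identify $PSL(2,\mathbb R)$ with the unit sphere bundle $S\mathbb H$, with coordinates $(x,y,\theta)$, where $\theta$ is the angle of the unit vector, measured from the positive $x$-direction. Let $\Gamma\le PSL(2,\mathbb R)$ be any cocompact lattice (discrete subgroup with compact quotient) and $M=\Gamma\backslash PSL(2,\mathbb R)$, with universal cover $\widetilde M=\widetilde{S\mathbb H}=\mathbb H\times\mathbb R$ (so $\theta\in\mathbb R$ on $\widetilde M$). Consider on $T\widetilde M$ $$L=\frac{1}{2y^2}\bigl(\dot x^2+\dot y^2+(y\dot\theta+\dot x)^2\bigr)+\dot\theta+\frac{\dot x}{y}.$$ For a cover $\widehat M$ of $M$ between $\widetilde M$ and $M$, let $c(\widehat M)$ be the infimum of all $k\in\mathbb R$ such that $\int_0^T (L+k)(\gamma,\dot\gamma)\,dt\ge 0$ for all $T>0$ and all absolutely continuous loops $\gamma:[0,T]\to\widehat M$. Put $c_u=c(\widetilde M)$ and $c_a=c(\overline M)$, where $\overline M$ is the abelian cover, the one with deck group $H_1(M;\mathbb Z)$. For $p,q\in\widetilde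 M$ and $T>0$ let $h^T(p,q)$ be the infimum of $\int_0^T L(\gamma,\dot\gamma)\,dt$ over all absolutely continuous $\gamma:[0,T]\to\widetilde M$ from $p$ to $q$, and let $$h(p,q)=\liminf_{T\to+\infty}\bigl[h^T(p,q)+c_u T\bigr]\in[-\infty,+\infty],\qquad \mathcal A=\{p\in\widetilde M: h(p,p)=0\}$$ be the Peierls barrier and the (projected) Aubry set of the universal cover. Then: 1. $L$ is invariant under all deck transformations of $\widetilde M\to M$, so it descends to $TM$ (and to every intermediate cover); 2. $c_u=\tfrac14$ and $c_a=\tfrac12$ (in particular $c_u<c_a$); 3. $h(p,p)=\pi$ for every $p\in\widetilde M$; 4. $h(p,q)$ is finite for all $p,q\in\widetilde M$; 5. $\mathcal A=\emptyset$. -/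

import Mathlib

namespace MagneticPSL

noncomputable section

open scoped MatrixGroups

/-- The group `PSL(2, ℝ)`, with its quotient topology. -/
abbrev PSL2R : Type := Matrix.ProjectiveSpecialLinearGroup (Fin 2) ℝ

/-- The universal cover of the unit sphere bundle of the hyperbolic plane: points `((x, y), θ)`
with `(x, y)` in the upper half plane and `θ` a lift to `ℝ` of the angle of the unit vector. -/
abbrev Cover : Type := UpperHalfPlane × ℝ

/-- The element of `SL(2, ℝ)` whose Möbius map takes the point `i` and the unit tangent vector of
angle `0` there to the point `q.1` and the unit tangent vector of angle `q.2` there. -/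
def toSL (q : Cover) : SL(2, ℝ) :=
  ⟨!![√q.1.im, q.1.re / √q.1.im; 0, 1 / √q.1.im] *
      !![Real.cos (q.2 / 2), Real.sin (q.2 / 2); -Real.sin (q.2 / 2), Real.cos (q.2 / 2)], by
    have h : √q.1.im ≠ 0 := (Real.sqrt_pos.2 q.1.im_pos).ne'
    rw [Matrix.det_mul, Matrix.det_fin_two_of, Matrix.det_fin_two_of]
    have := Real.sin_sq_add_cos_sq (q.2 / 2)
    field_simp
    linear_combination √q.1.im * this⟩

/-- The manifold `M = Γ \ PSL(2, ℝ)` of cosets `Γ g`. -/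
abbrev QuotientManifold (Γ : Subgroup PSL2R) : Type := Quotient (QuotientGroup.rightRel Γ)

/-- The universal covering map of `M = Γ \ PSL(2, ℝ)`: the composition of the covering
of `PSL(2, ℝ)`, identified with the unit sphere bundle, and the quotient map. -/
def proj (Γ : Subgroup PSL2R) (q : Cover) : QuotientManifold Γ :=
  Quotient.mk (QuotientGroup.rightRel Γ) ((toSL q : SL(2, ℝ)) : PSL2R)

/-- The group of deck transformations of the universal covering of `M = Γ \ PSL(2, ℝ)`. -/
def deckGroup (Γ : Subgroup PSL2R) : Subgroup (Cover ≃ₜ Cover) where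
  carrier := {φ | ∀ q, proj Γ (φ q) = proj Γ q}
  mul_mem' {φ ψ} hφ hψ q := (hφ (ψ q)).trans (hψ q)
  one_mem' _ := rfl
  inv_mem' {φ} hφ q := by
    have h := hφ (φ⁻¹ q)
    have e : φ (φ⁻¹ q) = q := φ.apply_symm_apply q
    rw [e] at h
    exact h.symm

/-- The magnetic Lagrangian
`(ẋ² + ẏ² + (y θ̇ + ẋ)²) / (2 y²) + θ̇ + ẋ / y`
at the point `q = ((x, y), θ)` and the velocity `v = (ẋ, ẏ, θ̇)`. -/
def lagrangian (q : Cover) (v : ℝ × ℝ × ℝ) : ℝ :=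
  1 / (2 * q.1.im ^ 2) * (v.1 ^ 2 + v.2.1 ^ 2 + (q.1.im * v.2.2 + v.1) ^ 2)
    + v.2.2 + v.1 / q.1.im

/-- The curve `γ` is differentiable at time `t`, in the coordinates `(x, y, θ)`. -/
def CurveDifferentiableAt (γ : ℝ → Cover) (t : ℝ) : Prop :=
  DifferentiableAt ℝ (fun s => (γ s).1.re) t ∧ DifferentiableAt ℝ (fun s => (γ s).1.im) t ∧
    DifferentiableAt ℝ (fun s => (γ s).2) t

/-- The velocity `(ẋ, ẏ, θ̇)` of a curve. -/
def velocity (γ : ℝ → Cover) (t : ℝ) : ℝ × ℝ × ℝ :=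
  (deriv (fun s => (γ s).1.re) t, deriv (fun s => (γ s).1.im) t, deriv (fun s => (γ s).2) t)

/-- The curve `γ` is absolutely continuous on `[0, T]`. -/
def IsACCurve (γ : ℝ → Cover) (T : ℝ) : Prop :=
  AbsolutelyContinuousOnInterval (fun s => (γ s).1.re) 0 T ∧
    AbsolutelyContinuousOnInterval (fun s => (γ s).1.im) 0 T ∧
    AbsolutelyContinuousOnInterval (fun s => (γ s).2) 0 T

open Classical in
/-- The action of `L + k` on `γ` restricted to `[0, T]`. The Lagrangian is bounded below, so that
the action of an absolutely continuous curve along which it is not integrable is `+∞`. -/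
def action (k : ℝ) (γ : ℝ → Cover) (T : ℝ) : EReal :=
  if IntervalIntegrable (fun t => lagrangian (γ t) (velocity γ t)) MeasureTheory.volume 0 T then
    ((∫ t in (0 : ℝ)..T, (lagrangian (γ t) (velocity γ t) + k) : ℝ) : EReal)
  else ⊤

/-- For a group `K` of deck transformations, the Mañé critical value of the cover
`K \ Cover` of `M`: the infimum of the `k` such that every absolutely continuous loop in
this cover has nonnegative `(L + k)`-action. Loops in `K \ Cover` are given by
their lifts, the curves in `Cover` whose endpoints are identified by an element of `K`. -/
def criticalValue (K : Subgroup (Cover ≃ₜ Cover)) : ℝ :=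
  sInf {k : ℝ | ∀ (T : ℝ) (γ : ℝ → Cover), 0 < T → IsACCurve γ T →
    (∃ φ ∈ K, φ (γ 0) = γ T) → 0 ≤ action k γ T}

/-- The critical value `c_u` of the universal cover. -/
def cUniversal : ℝ := criticalValue ⊥

/-- The critical value `c_a` of the abelian cover of `M = Γ \ PSL(2, ℝ)`, the cover with
deck group `H₁(M; ℤ)`: the quotient of the universal cover by the commutator subgroup of its
deck group. -/
def cAbelian (Γ : Subgroup PSL2R) : ℝ := criticalValue ⁅deckGroup Γ, deckGroup Γ⁆

/-- The finite time potential `h^T` on the universal cover. -/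
def finiteTimePotential (T : ℝ) (p q : Cover) : EReal :=
  ⨅ (γ : ℝ → Cover) (_ : IsACCurve γ T ∧ γ 0 = p ∧ γ T = q), action 0 γ T

/-- The Peierls barrier `h` on the universal cover. -/
def peierlsBarrier (p q : Cover) : EReal :=
  Filter.liminf (fun T : ℝ => finiteTimePotential T p q + ((cUniversal * T : ℝ) : EReal))
    Filter.atTop

/-- The projected Aubry set of the universal cover. -/
def aubrySet : Set Cover := {p | peierlsBarrier p p = 0}

end

end MagneticPSL

open MagneticPSL

namespace MagneticPSL

open MeasureTheory Set Filter
open scoped MatrixGroups Topology ENNReal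

noncomputable section

/-! ### Absolutely continuous functions -/

/-! Put u = ẋ/y, v = ẏ/y (velocity in an orthonormal frame) and w = θ̇ + ẋ/y (connection form). Then
L = (u² + v² + w²)/2 + w. Deck transformations are lifts of isometries composed with fibre
translations by multiples of 2π; they preserve u² + v² and w, hence L.

Universal cover. Let r be the distance to a centre p and S = `phase p`. Half the connection form is
dS + β, where β is a one-form on the base, rotationally symmetric about p and orthogonal to dr, with
|β| = tanh(r/2)/2. Completing squares, L + 1/4 - dS = (w + 1/2)²/2 + |(u, v) + β|²/2 + sech²(r/2)/8
(`excess_bounds`). This is nonnegative, so c_u ≤ 1/4. Since β is orthogonal to dr, the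
arithmetic-geometric mean inequality shows that the excess also dominates |dG| for G = arctan
sinh(r/2), which increases from 0 to π/2. A long loop at p therefore either stays in a ball and pays
an amount proportional to T, or goes far out and back and pays almost 2 · π/2 (`loop_bound`).
Conversely, lifted circles with sinh²(r/2) = T/(8π), run in time T with w = -1/2, have (L +
1/4)-action exactly π (`exists_loop`). Hence c_u = 1/4 and h(p,p) = π, so the Aubry set is empty.
For general p and q, S bounds h from below, and a loop followed by a fixed connecting curve bounds
it from above.

Abelian cover. L + 1/2 = (u² + v² + (w + 1)²)/2 is nonnegative and vanishes along the fibre run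
backwards, so c_a = 1/2 as soon as some power of the full fibre turn is a product of commutators.
For this it is enough that every homomorphism f from the deck group to ℝ kills the turn
(`map_fibreTurn_eq_zero`). Choose F with F ∘ φ = F + f(φ) for deck transformations φ. The average of
F ∘ ψ - F over M is additive in volume preserving maps ψ commuting with the deck group. Right
translations are such maps: the flow g_s of the diagonal group and the fibre rotations r_t. For one
value of s, (g_s r_π)² = r_{2π} = (g_s r_{2π/3})⁴. If A and Z are the averages of g_s and r_{2π},
then 2(A + Z/2) = Z = 4(A + Z/3), so Z = 0; but Z is f(turn) times the positive volume of M. -/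

theorem _root_.AbsolutelyContinuousOnInterval.comp_contDiffOn {f g : ℝ → ℝ} {a b : ℝ}
    (hf : AbsolutelyContinuousOnInterval f a b) {s : Set ℝ} (hg : ContDiffOn ℝ 1 g s)
    (hs : MapsTo f (uIcc a b) s) :
    AbsolutelyContinuousOnInterval (fun t => g (f t)) a b := by
  have hconv : Convex ℝ (f '' uIcc a b) :=
    (isPreconnected_uIcc.image f hf.continuousOn).ordConnected.convex
  obtain ⟨K, hK⟩ := (hg.mono hs.image_subset).exists_lipschitzOnWith (by decide) hconv
    (isCompact_uIcc.image_of_continuousOn hf.continuousOn)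
  rw [absolutelyContinuousOnInterval_iff] at hf ⊢
  intro ε hε
  obtain ⟨δ, hδ, h⟩ := hf (ε / (K + 1)) (by positivity)
  refine ⟨δ, hδ, fun E hE hlt => ?_⟩
  have h1 := h E hE hlt
  calc ∑ i ∈ Finset.range E.1, dist (g (f (E.2 i).1)) (g (f (E.2 i).2))
      ≤ ∑ i ∈ Finset.range E.1, K * dist (f (E.2 i).1) (f (E.2 i).2) := by
        refine Finset.sum_le_sum fun i hi => ?_
        exact hK.dist_le_mul _ (mem_image_of_mem f (hE.1 i hi).1) _
          (mem_image_of_mem f (hE.1 i hi).2)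
    _ = K * ∑ i ∈ Finset.range E.1, dist (f (E.2 i).1) (f (E.2 i).2) := by
        rw [Finset.mul_sum]
    _ ≤ (K + 1) * ∑ i ∈ Finset.range E.1, dist (f (E.2 i).1) (f (E.2 i).2) := by
        have : 0 ≤ ∑ i ∈ Finset.range E.1, dist (f (E.2 i).1) (f (E.2 i).2) :=
          Finset.sum_nonneg fun _ _ => dist_nonneg
        nlinarith
    _ < (K + 1) * (ε / (K + 1)) := by gcongr
    _ = ε := by field_simp

theorem _root_.AbsolutelyContinuousOnInterval.const (c a b : ℝ) :
    AbsolutelyContinuousOnInterval (fun _ : ℝ => c) a b :=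
  (contDiffOn_const (n := 1)).absolutelyContinuousOnInterval

theorem _root_.AbsolutelyContinuousOnInterval.fun_div {f g : ℝ → ℝ} {a b : ℝ}
    (hf : AbsolutelyContinuousOnInterval f a b) (hg : AbsolutelyContinuousOnInterval g a b)
    (h0 : ∀ t, g t ≠ 0) : AbsolutelyContinuousOnInterval (fun t => f t / g t) a b := by
  have h1 : AbsolutelyContinuousOnInterval (fun t => (g t)⁻¹) a b :=
    hg.comp_contDiffOn (g := fun r => r⁻¹) (s := {0}ᶜ)
      (fun r hr => (contDiffAt_inv ℝ hr).contDiffWithinAt) (fun t _ => h0 t)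
  simpa [div_eq_mul_inv] using hf.fun_mul h1

/-- An absolutely continuous function whose derivative is a.e. at most an integrable function `g`
grows at most by the integral of `g`. -/
theorem _root_.AbsolutelyContinuousOnInterval.sub_le_integral {f g : ℝ → ℝ} {a b : ℝ}
    (hab : a ≤ b) (hf : AbsolutelyContinuousOnInterval f a b)
    (hg : IntervalIntegrable g volume a b) (h : ∀ᵐ t, t ∈ Icc a b → deriv f t ≤ g t) :
    f b - f a ≤ ∫ t in a..b, g t := by
  rw [← hf.integral_deriv_eq_sub]
  refine intervalIntegral.integral_mono_ae_restrict hab hf.intervalIntegrable_deriv hg ?_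
  exact (ae_restrict_iff' measurableSet_Icc).2 h

/-! ### A family of subsolutions -/

/-- The square of the hyperbolic sine of half of the distance of the base points. -/
def radial (p q : Cover) : ℝ :=
  ((q.1.re - p.1.re) ^ 2 + (q.1.im - p.1.im) ^ 2) / (4 * q.1.im * p.1.im)

/-- Half of the fibre coordinate in the rotationally symmetric gauge centred at `p`. -/
def phase (p q : Cover) : ℝ :=
  q.2 / 2 + Real.arctan ((q.1.re - p.1.re) / (q.1.im + p.1.im))

/-- A regularisation of the Gudermannian function of half of the distance. -/
def gud (δ n : ℝ) : ℝ := Real.arctan √(δ + n)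

theorem radial_nonneg (p q : Cover) : 0 ≤ radial p q := by
  have := p.1.im_pos; have := q.1.im_pos
  unfold radial; positivity

theorem radial_self (p : Cover) : radial p p = 0 := by simp [radial]

/-- The arithmetic-geometric mean inequality applied to the two terms below E gives Q ≤ 4(1 + N)E².
The factor in the conclusion is the reciprocal of the derivative of `gud δ`, so the bound says that
E dominates the variation of `gud`. -/
theorem abs_le_of_energy_bound {N N' Q E δ : ℝ} (hN : 0 ≤ N) (hQ : 0 ≤ Q) (hδ : 0 ≤ δ)
    (hE : 1 / 8 * (1 / (1 + N)) + 1 / 2 * Q ≤ E) (hcs : N' ^ 2 ≤ N * (1 + N) * Q) :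
    |N'| ≤ 2 * √(δ + N) * (1 + (δ + N)) * E := by
  have hpos : 0 < 1 / (1 + N) := by positivity
  have hEpos : 0 ≤ E := le_trans (by positivity) hE
  have hE2 : Q ≤ 4 * (1 + N) * E ^ 2 := by
    have h1 : (1 / 8 * (1 / (1 + N)) + 1 / 2 * Q) ^ 2 ≤ E ^ 2 := by gcongr
    have h2 := four_mul_le_sq_add (1 / 8 * (1 / (1 + N))) (1 / 2 * Q)
    have h3 : Q = (1 + N) * (4 * (4 * (1 / 8 * (1 / (1 + N))) * (1 / 2 * Q))) := by
      field_simp; ring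
    rw [h3]
    have h4 := mul_le_mul_of_nonneg_left (h2.trans h1) (show 0 ≤ 4 * (1 + N) by positivity)
    linarith
  refine abs_le_of_sq_le_sq ?_ (by positivity)
  have hs : √(δ + N) ^ 2 = δ + N := Real.sq_sqrt (by positivity)
  calc N' ^ 2 ≤ N * (1 + N) * Q := hcs
    _ ≤ N * (1 + N) * (4 * (1 + N) * E ^ 2) := by gcongr
    _ = 4 * N * (1 + N) ^ 2 * E ^ 2 := by ring
    _ ≤ 4 * (δ + N) * (1 + (δ + N)) ^ 2 * E ^ 2 := by gcongr <;> linarith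
    _ = (2 * √(δ + N) * (1 + (δ + N)) * E) ^ 2 := by rw [mul_pow, mul_pow, mul_pow, hs]; ring

/-- Pointwise core of the lower bounds. E is L + 1/4 minus the derivative of `phase`, N is
sinh²(r/2) and N' its derivative along the velocity (p, q, r). Everything follows from writing E as
a sum of squares plus 1/(8(1 + N)). -/
theorem excess_bounds {X y y₀ p q r : ℝ} (hy : 0 < y) (hy₀ : 0 < y₀) {δ : ℝ} (hδ : 0 ≤ δ) :
    let N := (X ^ 2 + (y - y₀) ^ 2) / (4 * y * y₀)
    let N' := (2 * X * p + 2 * (y - y₀) * q) / (4 * y * y₀) - N * q / y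
    let E := 1 / (2 * y ^ 2) * (p ^ 2 + q ^ 2 + (y * r + p) ^ 2) + r + p / y + 1 / 4
      - (r / 2 + (p * (y + y₀) - X * q) / ((y + y₀) ^ 2 + X ^ 2))
    1 / (8 * (1 + N)) ≤ E ∧ |N'| ≤ 2 * √(δ + N) * (1 + (δ + N)) * E := by
  intro N N' E
  have hD : 0 < (y + y₀) ^ 2 + X ^ 2 := by positivity
  set D := (y + y₀) ^ 2 + X ^ 2 with hDdef
  -- U and V are the frame velocities shifted by the components of β, the part of half the
  -- connection form left after subtracting the derivative of `phase`.
  obtain ⟨U, hU⟩ : ∃ U, U = p / y + (1 / 2 - y * (y + y₀) / D) := ⟨_, rfl⟩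
  obtain ⟨V, hV⟩ : ∃ V, V = q / y + y * X / D := ⟨_, rfl⟩
  have hN : 0 ≤ N := by positivity
  have hρ : 1 / (1 + N) = 4 * y * y₀ / D := by
    have : 1 + N = D / (4 * y * y₀) := by
      simp only [N, hDdef]; field_simp; ring
    rw [this]; field_simp
  have hE : E = 1 / 2 * (r + p / y + 1 / 2) ^ 2 + 1 / 8 * (1 / (1 + N))
      + 1 / 2 * (U ^ 2 + V ^ 2) := by
    rw [hρ, hU, hV]
    simp only [E]
    rw [← sub_eq_zero]
    field_simp
    rw [hDdef]
    ring
  -- The shifted velocities may replace the true ones here because β is orthogonal to the gradient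
  -- of N.
  have hN' : N' = X / (2 * y₀) * U + (y ^ 2 - y₀ ^ 2 - X ^ 2) / (4 * y * y₀) * V := by
    rw [hU, hV]
    simp only [N', N]
    rw [← sub_eq_zero]
    field_simp
    rw [hDdef]
    ring
  -- The squared norm of the gradient of sinh²(r/2) is sinh²(r/2) cosh²(r/2).
  have hgrad : (X / (2 * y₀)) ^ 2 + ((y ^ 2 - y₀ ^ 2 - X ^ 2) / (4 * y * y₀)) ^ 2
      = N * (1 + N) := by
    simp only [N]; field_simp; ring
  have hQ : 0 ≤ U ^ 2 + V ^ 2 := by positivity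
  have hE0 : 1 / 8 * (1 / (1 + N)) + 1 / 2 * (U ^ 2 + V ^ 2) ≤ E := by
    have := sq_nonneg (r + p / y + 1 / 2)
    rw [hE]; linarith
  have hfirst : 1 / (8 * (1 + N)) = 1 / 8 * (1 / (1 + N)) := by field_simp
  refine ⟨by rw [hfirst]; linarith, abs_le_of_energy_bound hN hQ hδ hE0 ?_⟩
  rw [← hgrad, hN']
  nlinarith [sq_nonneg (X / (2 * y₀) * V - (y ^ 2 - y₀ ^ 2 - X ^ 2) / (4 * y * y₀) * U)]

theorem hasDerivAt_radial (p : Cover) {γ : ℝ → Cover} {t : ℝ} (h : CurveDifferentiableAt γ t) :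
    HasDerivAt (fun s => radial p (γ s))
      ((2 * ((γ t).1.re - p.1.re) * (velocity γ t).1
          + 2 * ((γ t).1.im - p.1.im) * (velocity γ t).2.1) / (4 * (γ t).1.im * p.1.im)
        - radial p (γ t) * (velocity γ t).2.1 / (γ t).1.im) t := by
  obtain ⟨hx, hy, -⟩ := h
  have hp := p.1.im_pos
  have hq := (γ t).1.im_pos
  have h1 := (((hx.hasDerivAt.sub_const p.1.re).pow 2).add
    ((hy.hasDerivAt.sub_const p.1.im).pow 2)).div
    ((hy.hasDerivAt.const_mul 4).mul_const p.1.im) (by positivity)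
  refine h1.congr_deriv ?_
  simp only [velocity, radial, Pi.add_apply, Pi.pow_apply]
  field_simp
  ring

theorem hasDerivAt_phase (p : Cover) {γ : ℝ → Cover} {t : ℝ} (h : CurveDifferentiableAt γ t) :
    HasDerivAt (fun s => phase p (γ s))
      ((velocity γ t).2.2 / 2 + ((velocity γ t).1 * ((γ t).1.im + p.1.im)
          - ((γ t).1.re - p.1.re) * (velocity γ t).2.1)
        / (((γ t).1.im + p.1.im) ^ 2 + ((γ t).1.re - p.1.re) ^ 2)) t := by
  obtain ⟨hx, hy, hθ⟩ := h
  have hp := p.1.im_pos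
  have hq := (γ t).1.im_pos
  have h1 := (hθ.hasDerivAt.div_const 2).add ((hx.hasDerivAt.sub_const p.1.re).div
    (hy.hasDerivAt.add_const p.1.im) (by positivity)).arctan
  refine h1.congr_deriv ?_
  simp only [velocity, Pi.div_apply]
  congr 1
  field_simp

theorem hasDerivAt_gud {δ n : ℝ} (h : 0 < δ + n) :
    HasDerivAt (gud δ) (1 / (2 * √(δ + n) * (1 + (δ + n)))) n := by
  have h1 := (((hasDerivAt_id n).const_add δ).sqrt h.ne').arctan
  refine h1.congr_deriv ?_
  simp only [id, Real.sq_sqrt h.le]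
  field_simp

/-- Positivity of δ is needed at n = 0: without it the square root fails to be differentiable at the
centre, where the loops to be estimated start. -/
theorem contDiffOn_gud {δ : ℝ} (hδ : 0 < δ) : ContDiffOn ℝ 1 (gud δ) (Ici 0) := by
  intro n hn
  have : δ + n ≠ 0 := by have := mem_Ici.1 hn; positivity
  exact ((contDiffAt_const.add contDiffAt_id).sqrt this).arctan.contDiffWithinAt

theorem IsACCurve.radial_comp {γ : ℝ → Cover} {T : ℝ} (h : IsACCurve γ T) (p : Cover) :
    AbsolutelyContinuousOnInterval (fun s => radial p (γ s)) 0 T := by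
  obtain ⟨hx, hy, -⟩ := h
  have hX := hx.fun_sub (.const p.1.re 0 T)
  have hY := hy.fun_sub (.const p.1.im 0 T)
  have hden := (hy.const_mul 4).fun_mul (.const p.1.im 0 T)
  have := ((hX.fun_mul hX).fun_add (hY.fun_mul hY)).fun_div hden (fun t => by
    have := p.1.im_pos; have := (γ t).1.im_pos; positivity)
  simpa only [radial, sq] using this

theorem IsACCurve.phase_comp {γ : ℝ → Cover} {T : ℝ} (h : IsACCurve γ T) (p : Cover) :
    AbsolutelyContinuousOnInterval (fun s => phase p (γ s)) 0 T := by
  obtain ⟨hx, hy, hθ⟩ := h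
  have hq := ((hx.fun_sub (.const p.1.re 0 T)).fun_div (hy.fun_add (.const p.1.im 0 T))
    (fun t => by have := p.1.im_pos; have := (γ t).1.im_pos; positivity)).comp_contDiffOn
    (g := Real.arctan) (s := univ) Real.contDiff_arctan.contDiffOn (mapsTo_univ _ _)
  have := (hθ.const_mul (1 / 2)).fun_add hq
  refine Eq.mp ?_ this
  congr 1
  ext s
  simp only [phase]
  ring

theorem IsACCurve.gud_comp {γ : ℝ → Cover} {T : ℝ} (h : IsACCurve γ T) (p : Cover) {δ : ℝ}
    (hδ : 0 < δ) : AbsolutelyContinuousOnInterval (fun s => gud δ (radial p (γ s))) 0 T :=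
  (h.radial_comp p).comp_contDiffOn (contDiffOn_gud hδ) (fun t _ => radial_nonneg p (γ t))

theorem IsACCurve.ae_differentiableAt {γ : ℝ → Cover} {T : ℝ} (h : IsACCurve γ T) :
    ∀ᵐ t, t ∈ uIcc 0 T → CurveDifferentiableAt γ t := by
  filter_upwards [h.1.ae_differentiableAt, h.2.1.ae_differentiableAt,
    h.2.2.ae_differentiableAt] with t h1 h2 h3 ht
  exact ⟨h1 ht, h2 ht, h3 ht⟩

theorem excess_ge (p : Cover) {γ : ℝ → Cover} {t : ℝ} (h : CurveDifferentiableAt γ t) :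
    deriv (fun s => phase p (γ s)) t + 1 / (8 * (1 + radial p (γ t)))
      ≤ lagrangian (γ t) (velocity γ t) + 1 / 4 := by
  have h1 := (excess_bounds (X := (γ t).1.re - p.1.re) (p := (velocity γ t).1)
    (q := (velocity γ t).2.1) (r := (velocity γ t).2.2) (γ t).1.im_pos p.1.im_pos
    (δ := 0) le_rfl).1
  rw [(hasDerivAt_phase p h).deriv]
  unfold lagrangian radial
  linarith

theorem excess_ge_gud (p : Cover) {γ : ℝ → Cover} {t : ℝ} (h : CurveDifferentiableAt γ t)
    {δ : ℝ} (hδ : 0 < δ) :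
    deriv (fun s => phase p (γ s)) t + |deriv (fun s => gud δ (radial p (γ s))) t|
      ≤ lagrangian (γ t) (velocity γ t) + 1 / 4 := by
  have h1 := (excess_bounds (X := (γ t).1.re - p.1.re) (p := (velocity γ t).1)
    (q := (velocity γ t).2.1) (r := (velocity γ t).2.2) (γ t).1.im_pos p.1.im_pos hδ.le).2
  have hN := radial_nonneg p (γ t)
  have hpos : 0 < δ + radial p (γ t) := by positivity
  have h2 := ((hasDerivAt_gud hpos).comp t (hasDerivAt_radial p h)).deriv
  rw [(hasDerivAt_phase p h).deriv]
  change _ + |deriv (gud δ ∘ fun s => radial p (γ s)) t| ≤ _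
  rw [h2, abs_mul, abs_of_pos (by positivity), one_div_mul_eq_div]
  have h3 := (div_le_iff₀' (c := 2 * √(δ + radial p (γ t)) * (1 + (δ + radial p (γ t))))
    (by positivity)).2 h1
  have h4 : radial p (γ t) = (((γ t).1.re - p.1.re) ^ 2 + ((γ t).1.im - p.1.im) ^ 2) /
    (4 * (γ t).1.im * p.1.im) := rfl
  rw [← h4] at h3
  unfold lagrangian
  linarith

/-! ### Integrated lower bounds for the (L + 1/4)-action -/

section Bounds

variable {γ : ℝ → Cover} {T : ℝ} (hγ : IsACCurve γ T)
  (hint : IntervalIntegrable (fun t => lagrangian (γ t) (velocity γ t)) volume 0 T)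

include hγ hint

theorem phase_sub_le (p : Cover) (hT : 0 ≤ T) :
    phase p (γ T) - phase p (γ 0) ≤ ∫ t in (0 : ℝ)..T, (lagrangian (γ t) (velocity γ t) + 1 / 4) := by
  refine (hγ.phase_comp p).sub_le_integral hT (hint.add intervalIntegrable_const) ?_
  filter_upwards [hγ.ae_differentiableAt] with t ht htm
  have := excess_ge p (ht (by rwa [uIcc_of_le hT]))
  have h0 := radial_nonneg p (γ t)
  have : 0 ≤ 1 / (8 * (1 + radial p (γ t))) := by positivity
  linarith

/-- Within bounded distance of p the term sech²(r/2)/8 of the excess stays away from zero, so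
staying there costs a positive amount per unit of time. -/
theorem phase_sub_add_le (p : Cover) (hT : 0 ≤ T) {R : ℝ}
    (hR : ∀ t ∈ Icc 0 T, radial p (γ t) ≤ R) :
    phase p (γ T) - phase p (γ 0) + T / (8 * (1 + R))
      ≤ ∫ t in (0 : ℝ)..T, (lagrangian (γ t) (velocity γ t) + 1 / 4) := by
  have h := ((hγ.phase_comp p).sub_le_integral hT (g := fun t =>
    lagrangian (γ t) (velocity γ t) + 1 / 4 - 1 / (8 * (1 + R)))
    ((hint.add intervalIntegrable_const).sub intervalIntegrable_const) ?_)
  · rw [intervalIntegral.integral_sub (hint.add intervalIntegrable_const)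
      intervalIntegrable_const, intervalIntegral.integral_const] at h
    simp only [smul_eq_mul, sub_zero, mul_one_div] at h
    linarith
  · filter_upwards [hγ.ae_differentiableAt] with t ht htm
    have := excess_ge p (ht (by rwa [uIcc_of_le hT]))
    have h0 := radial_nonneg p (γ t)
    have h1 : 1 / (8 * (1 + R)) ≤ 1 / (8 * (1 + radial p (γ t))) := by
      have := hR t htm
      gcongr
    linarith

/-- The excess dominates the absolute value of the derivative of `gud`, so either sign can be
integrated: σ = 1 serves on the way out, σ = -1 on the way back. -/
theorem phase_gud_le (p : Cover) {σ : ℝ} (hσ : |σ| = 1) {δ : ℝ} (hδ : 0 < δ) {a b : ℝ}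
    (ha : 0 ≤ a) (hab : a ≤ b) (hb : b ≤ T) :
    phase p (γ b) - phase p (γ a) + σ * (gud δ (radial p (γ b)) - gud δ (radial p (γ a)))
      ≤ ∫ t in a..b, (lagrangian (γ t) (velocity γ t) + 1 / 4) := by
  have hsub : uIcc a b ⊆ uIcc 0 T := by
    rw [uIcc_of_le hab, uIcc_of_le (ha.trans (hab.trans hb))]
    exact Icc_subset_Icc ha hb
  have h := (((hγ.phase_comp p).fun_add ((hγ.gud_comp p hδ).const_mul σ)).mono hsub).sub_le_integral hab
    ((hint.mono_set hsub).add (intervalIntegrable_const (c := 1 / 4))) ?_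
  · linarith
  · filter_upwards [hγ.ae_differentiableAt] with t ht htm
    have hd := ht (hsub (by rwa [uIcc_of_le hab]))
    have h1 := excess_ge_gud p hd hδ
    have hN := radial_nonneg p (γ t)
    have d1 := (hasDerivAt_phase p hd).differentiableAt
    have d2 : DifferentiableAt ℝ (fun s => gud δ (radial p (γ s))) t :=
      ((hasDerivAt_gud (by positivity)).comp t (hasDerivAt_radial p hd)).differentiableAt
    rw [deriv_fun_add d1 (d2.const_mul σ), deriv_const_mul _ d2]
    have h2 : σ * deriv (fun s => gud δ (radial p (γ s))) t
        ≤ |deriv (fun s => gud δ (radial p (γ s))) t| := by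
      refine (le_abs_self _).trans ?_
      rw [abs_mul, hσ, one_mul]
    linarith

/-- A long loop in the universal cover either stays near its starting point, or goes far away and
returns. -/
theorem loop_bound (hT : 0 ≤ T) (hloop : γ 0 = γ T) {δ : ℝ} (hδ : 0 < δ) (R : ℝ) :
    min (T / (8 * (1 + R))) (2 * (gud δ R - gud δ 0))
      ≤ ∫ t in (0 : ℝ)..T, (lagrangian (γ t) (velocity γ t) + 1 / 4) := by
  by_cases h : ∀ t ∈ Icc 0 T, radial (γ 0) (γ t) ≤ R
  · refine (min_le_left _ _).trans ?_
    have := phase_sub_add_le hγ hint (γ 0) hT h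
    rwa [← hloop, sub_self, zero_add] at this
  -- At a time s the curve lies beyond radius R. The parts before and after s each pay the increment
  -- of `gud`, while the phase terms cancel because the curve is a loop.
  · push Not at h
    obtain ⟨s, ⟨hs0, hsT⟩, hs⟩ := h
    refine (min_le_right _ _).trans ?_
    have h1 := phase_gud_le hγ hint (γ 0) (σ := 1) (by simp) hδ le_rfl hs0 hsT
    have h2 := phase_gud_le hγ hint (γ 0) (σ := -1) (by simp) hδ hs0 hsT le_rfl
    have hi := hint.add (intervalIntegrable_const (c := (1 / 4 : ℝ)))
    have h3 := intervalIntegral.integral_add_adjacent_intervals (a := 0) (b := s) (c := T)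
      (hi.mono_set (by rw [uIcc_of_le hs0, uIcc_of_le hT]; exact Icc_subset_Icc le_rfl hsT))
      (hi.mono_set (by rw [uIcc_of_le hsT, uIcc_of_le hT]; exact Icc_subset_Icc hs0 le_rfl))
    rw [← hloop, radial_self] at h2
    rw [radial_self] at h1
    have h4 : gud δ R ≤ gud δ (radial (γ 0) (γ s)) :=
      Real.arctan_mono (Real.sqrt_le_sqrt (by linarith))
    linarith

end Bounds

/-! ### Smooth curves and concatenation -/

/-- The coordinates of the curve are continuously differentiable. -/
def IsC1Curve (γ : ℝ → Cover) : Prop :=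
  ContDiff ℝ 1 (fun s => (γ s).1.re) ∧ ContDiff ℝ 1 (fun s => (γ s).1.im) ∧
    ContDiff ℝ 1 (fun s => (γ s).2)

theorem IsC1Curve.isACCurve {γ : ℝ → Cover} (h : IsC1Curve γ) (T : ℝ) : IsACCurve γ T :=
  ⟨h.1.contDiffOn.absolutelyContinuousOnInterval, h.2.1.contDiffOn.absolutelyContinuousOnInterval,
    h.2.2.contDiffOn.absolutelyContinuousOnInterval⟩

theorem IsC1Curve.continuous_lagrangian {γ : ℝ → Cover} (h : IsC1Curve γ) :
    Continuous fun t => lagrangian (γ t) (velocity γ t) := by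
  have h1 := h.1.continuous_deriv le_rfl
  have h2 := h.2.1.continuous_deriv le_rfl
  have h3 := h.2.2.continuous_deriv le_rfl
  have hy := h.2.1.continuous
  have h0 : ∀ t, (γ t).1.im ≠ 0 := fun t => (γ t).1.im_pos.ne'
  unfold lagrangian velocity
  dsimp only
  refine (((Continuous.div continuous_const (by fun_prop) fun t => ?_).mul (by fun_prop)).add
    (by fun_prop)).add (h1.div hy h0)
  have := (γ t).1.im_pos
  positivity

theorem action_eq {γ : ℝ → Cover} {T : ℝ} (k : ℝ)
    (h : IntervalIntegrable (fun t => lagrangian (γ t) (velocity γ t)) volume 0 T) :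
    action k γ T =
      ((∫ t in (0 : ℝ)..T, (lagrangian (γ t) (velocity γ t) + 1 / 4)) + (k - 1 / 4) * T : ℝ) := by
  rw [action, if_pos h]
  congr 1
  rw [intervalIntegral.integral_add h intervalIntegrable_const,
    intervalIntegral.integral_add h intervalIntegrable_const]
  simp
  ring

/-- Curves with non-integrable Lagrangian have action `⊤`, so only integrable ones need an estimate.
-/
theorem le_action {γ : ℝ → Cover} {T k C : ℝ}
    (h : IntervalIntegrable (fun t => lagrangian (γ t) (velocity γ t)) volume 0 T →
      C ≤ (∫ t in (0 : ℝ)..T, (lagrangian (γ t) (velocity γ t) + 1 / 4)) + (k - 1 / 4) * T) :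
    (C : EReal) ≤ action k γ T := by
  by_cases hi : IntervalIntegrable (fun t => lagrangian (γ t) (velocity γ t)) volume 0 T
  · rw [action_eq k hi]
    exact EReal.coe_le_coe_iff.2 (h hi)
  · rw [action, if_neg hi]
    exact le_top

/-- The concatenation of two curves at time `T`. -/
def concat (γ₁ γ₂ : ℝ → Cover) (T : ℝ) (t : ℝ) : Cover :=
  if t ≤ T then γ₁ t else γ₂ (t - T)

theorem absolutelyContinuousOnInterval_glue {f₁ f₂ : ℝ → ℝ} (h₁ : ContDiff ℝ 1 f₁)
    (h₂ : ContDiff ℝ 1 f₂) {T S : ℝ} (hT : 0 ≤ T) (hS : 0 ≤ S) (h : f₁ T = f₂ 0) :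
    AbsolutelyContinuousOnInterval (fun t => if t ≤ T then f₁ t else f₂ (t - T)) 0 (T + S) := by
  obtain ⟨K₁, hK₁⟩ := (h₁.contDiffOn (s := Icc 0 T)).exists_lipschitzOnWith (by decide)
    (convex_Icc _ _) isCompact_Icc
  obtain ⟨K₂, hK₂⟩ := (h₂.contDiffOn (s := Icc 0 S)).exists_lipschitzOnWith (by decide)
    (convex_Icc _ _) isCompact_Icc
  have hm : LipschitzWith 1 fun t : ℝ => min t T := LipschitzWith.id.min_const T
  have hM : LipschitzWith 1 fun t : ℝ => max (t - T) 0 :=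
    LipschitzWith.max_const (f := fun t : ℝ => t - T)
      (LipschitzWith.of_dist_le_mul fun x y => by simp) 0
  -- The glued function equals f₁(min t T) + f₂(max (t - T) 0) - f₂ 0, a sum of Lipschitz functions.
  have a₁ : AbsolutelyContinuousOnInterval (fun t => f₁ (min t T)) 0 (T + S) :=
    (hK₁.comp (hm.lipschitzOnWith (s := uIcc 0 (T + S))) fun t ht => by
      rw [uIcc_of_le (by positivity)] at ht
      exact ⟨le_min ht.1 hT, min_le_right _ _⟩).absolutelyContinuousOnInterval
  have a₂ : AbsolutelyContinuousOnInterval (fun t => f₂ (max (t - T) 0)) 0 (T + S) :=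
    (hK₂.comp (hM.lipschitzOnWith (s := uIcc 0 (T + S))) fun t ht => by
      rw [uIcc_of_le (by positivity)] at ht
      exact ⟨le_max_right _ _, max_le (by linarith [ht.2]) hS⟩).absolutelyContinuousOnInterval
  refine Eq.mp ?_ ((a₁.fun_add a₂).fun_sub (.const (f₂ 0) _ _))
  congr 1
  ext t
  split_ifs with ht
  · rw [min_eq_left ht, max_eq_right (by linarith)]; ring
  · rw [min_eq_right (by linarith), max_eq_left (by linarith), h]; ring

theorem isACCurve_concat {γ₁ γ₂ : ℝ → Cover} (h₁ : IsC1Curve γ₁) (h₂ : IsC1Curve γ₂) {T S : ℝ}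
    (hT : 0 ≤ T) (hS : 0 ≤ S) (h : γ₁ T = γ₂ 0) : IsACCurve (concat γ₁ γ₂ T) (T + S) := by
  refine ⟨?_, ?_, ?_⟩
  · refine Eq.mp ?_ (absolutelyContinuousOnInterval_glue h₁.1 h₂.1 hT hS (by rw [h]))
    congr 1; ext t; unfold concat; split_ifs <;> rfl
  · refine Eq.mp ?_ (absolutelyContinuousOnInterval_glue h₁.2.1 h₂.2.1 hT hS (by rw [h]))
    congr 1; ext t; unfold concat; split_ifs <;> rfl
  · refine Eq.mp ?_ (absolutelyContinuousOnInterval_glue h₁.2.2 h₂.2.2 hT hS (by rw [h]))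
    congr 1; ext t; unfold concat; split_ifs <;> rfl

theorem velocity_congr {γ₁ γ₂ : ℝ → Cover} {t : ℝ} (h : γ₁ =ᶠ[𝓝 t] γ₂) :
    velocity γ₁ t = velocity γ₂ t := by
  have h1 : (fun s => (γ₁ s).1.re) =ᶠ[𝓝 t] fun s => (γ₂ s).1.re := h.fun_comp fun q => q.1.re
  have h2 : (fun s => (γ₁ s).1.im) =ᶠ[𝓝 t] fun s => (γ₂ s).1.im := h.fun_comp fun q => q.1.im
  have h3 : (fun s => (γ₁ s).2) =ᶠ[𝓝 t] fun s => (γ₂ s).2 := h.fun_comp fun q => q.2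
  rw [velocity, velocity, h1.deriv_eq, h2.deriv_eq, h3.deriv_eq]

theorem velocity_comp_sub (γ : ℝ → Cover) (T t : ℝ) :
    velocity (fun s => γ (s - T)) t = velocity γ (t - T) := by
  unfold velocity
  rw [deriv_comp_sub_const (f := fun s => (γ s).1.re), deriv_comp_sub_const (f := fun s => (γ s).1.im),
    deriv_comp_sub_const (f := fun s => (γ s).2)]

theorem action_concat {γ₁ γ₂ : ℝ → Cover} (h₁ : IsC1Curve γ₁) (h₂ : IsC1Curve γ₂) {T S : ℝ}
    (hT : 0 ≤ T) (hS : 0 ≤ S) (k : ℝ) :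
    action k (concat γ₁ γ₂ T) (T + S) = action k γ₁ T + action k γ₂ S := by
  set L := fun t => lagrangian (concat γ₁ γ₂ T t) (velocity (concat γ₁ γ₂ T) t) with hL
  set L₁ := fun t => lagrangian (γ₁ t) (velocity γ₁ t) with hL₁
  set L₂ := fun t => lagrangian (γ₂ t) (velocity γ₂ t) with hL₂
  have c₁ : Continuous L₁ := h₁.continuous_lagrangian
  have c₂ : Continuous L₂ := h₂.continuous_lagrangian
  have e₁ : ∀ t < T, L₁ t = L t := fun t ht => by
    have : concat γ₁ γ₂ T =ᶠ[𝓝 t] γ₁ := by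
      filter_upwards [Iio_mem_nhds ht] with s hs
      exact if_pos (le_of_lt hs)
    simp only [hL, hL₁, velocity_congr this, this.self_of_nhds]
  have e₂ : ∀ t, T < t → L₂ (t - T) = L t := fun t ht => by
    have : concat γ₁ γ₂ T =ᶠ[𝓝 t] fun s => γ₂ (s - T) := by
      filter_upwards [Ioi_mem_nhds ht] with s hs
      exact if_neg (not_le_of_gt hs)
    simp only [hL, hL₂, velocity_congr this, velocity_comp_sub]
    rw [this.self_of_nhds]
  have c₂' : Continuous fun t => L₂ (t - T) := c₂.comp (continuous_sub_right T)
  -- The velocity at the junction time is uncontrolled, but a single time is negligible.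
  have n : ∀ᵐ t : ℝ, t ≠ T := by simp [ae_iff, measure_singleton]
  have r₁ : ∀ᵐ t, t ∈ uIoc 0 T → L₁ t = L t := by
    filter_upwards [n] with t ht htm
    rw [uIoc_of_le hT] at htm
    exact e₁ t (lt_of_le_of_ne htm.2 ht)
  have r₂ : ∀ᵐ t, t ∈ uIoc T (T + S) → L₂ (t - T) = L t := by
    refine ae_of_all _ fun t htm => ?_
    rw [uIoc_of_le (by linarith)] at htm
    exact e₂ t htm.1
  have i₁ : IntervalIntegrable L volume 0 T :=
    (c₁.intervalIntegrable 0 T).congr_ae ((ae_restrict_iff' measurableSet_uIoc).2 r₁)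
  have i₂ : IntervalIntegrable L volume T (T + S) :=
    (c₂'.intervalIntegrable T (T + S)).congr_ae ((ae_restrict_iff' measurableSet_uIoc).2 r₂)
  rw [action_eq k (i₁.trans i₂), action_eq k (c₁.intervalIntegrable 0 T),
    action_eq k (c₂.intervalIntegrable 0 S), ← EReal.coe_add]
  congr 1
  change (∫ t in (0 : ℝ)..(T + S), (L t + 1 / 4)) + _ =
    (∫ t in (0 : ℝ)..T, (L₁ t + 1 / 4)) + _ + ((∫ t in (0 : ℝ)..S, (L₂ t + 1 / 4)) + _)
  rw [← intervalIntegral.integral_add_adjacent_intervals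
    (i₁.add (intervalIntegrable_const (c := (1 / 4 : ℝ))))
    (i₂.add (intervalIntegrable_const (c := (1 / 4 : ℝ))))]
  have s₁ : ∫ t in (0 : ℝ)..T, (L t + 1 / 4) = ∫ t in (0 : ℝ)..T, (L₁ t + 1 / 4) := by
    refine intervalIntegral.integral_congr_ae ?_
    filter_upwards [r₁] with t ht htm
    rw [ht htm]
  have s₂ : ∫ t in T..(T + S), (L t + 1 / 4) = ∫ t in (0 : ℝ)..S, (L₂ t + 1 / 4) := by
    have := intervalIntegral.integral_comp_sub_right (a := T) (b := T + S)
      (fun t => L₂ t + 1 / 4) T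
    rw [sub_self, add_sub_cancel_left] at this
    rw [← this]
    refine intervalIntegral.integral_congr_ae ?_
    filter_upwards [r₂] with t ht htm
    rw [ht htm]
  rw [s₁, s₂]
  ring

/-! ### Explicit curves -/

/-- A curve from `p` to `q` in unit time. -/
def connect (p q : Cover) (t : ℝ) : Cover :=
  (⟨⟨p.1.re + t * (q.1.re - p.1.re), p.1.im * Real.exp (t * Real.log (q.1.im / p.1.im))⟩,
    mul_pos p.1.im_pos (Real.exp_pos _)⟩, p.2 + t * (q.2 - p.2))

theorem connect_zero (p q : Cover) : connect p q 0 = p := by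
  refine Prod.ext (UpperHalfPlane.ext (Complex.ext ?_ ?_)) ?_ <;> simp [connect]

theorem connect_one (p q : Cover) : connect p q 1 = q := by
  have hp := p.1.im_pos
  have hq := q.1.im_pos
  have : p.1.im * Real.exp (1 * Real.log (q.1.im / p.1.im)) = q.1.im := by
    rw [one_mul, Real.exp_log (by positivity)]; field_simp
  refine Prod.ext (UpperHalfPlane.ext (Complex.ext ?_ ?_)) ?_
  · simp [connect]
  · exact this
  · simp [connect]

theorem isC1Curve_connect (p q : Cover) : IsC1Curve (connect p q) := by
  refine ⟨?_, ?_, ?_⟩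
  · change ContDiff ℝ 1 fun t : ℝ => p.1.re + t * (q.1.re - p.1.re)
    fun_prop
  · change ContDiff ℝ 1 fun t : ℝ => p.1.im * Real.exp (t * Real.log (q.1.im / p.1.im))
    fun_prop
  · change ContDiff ℝ 1 fun t : ℝ => p.2 + t * (q.2 - p.2)
    fun_prop

theorem circle_denom_pos {τ : ℝ} (h₀ : 0 ≤ τ) (h₁ : τ < 1) (φ : ℝ) :
    0 < 1 + τ ^ 2 - 2 * τ * Real.cos φ := by
  nlinarith [Real.cos_le_one φ, mul_nonneg h₀ (sub_nonneg.2 (Real.cos_le_one φ))]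

theorem circle_cos_pos {τ : ℝ} (h₀ : 0 ≤ τ) (h₁ : τ < 1) (φ : ℝ) : 0 < 1 - τ * Real.cos φ := by
  nlinarith [Real.cos_le_one φ, mul_nonneg h₀ (sub_nonneg.2 (Real.cos_le_one φ))]

/-- The lift of a hyperbolic circle through `p`, traversed with constant speed, whose fibre
coordinate is constant in the gauge centred at the centre of the circle. -/
def circleLoop (p : Cover) {τ : ℝ} (h₀ : 0 ≤ τ) (h₁ : τ < 1) (ω t : ℝ) : Cover :=
  (⟨⟨p.1.re - 2 * p.1.im * τ * (1 - τ) / (1 + τ) * Real.sin (ω * t) /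
        (1 + τ ^ 2 - 2 * τ * Real.cos (ω * t)),
      p.1.im * (1 - τ) ^ 2 / (1 + τ ^ 2 - 2 * τ * Real.cos (ω * t))⟩,
    div_pos (mul_pos p.1.im_pos (pow_pos (sub_pos.2 h₁) 2)) (circle_denom_pos h₀ h₁ _)⟩,
    p.2 + 2 * Real.arctan (τ * Real.sin (ω * t) / (1 - τ * Real.cos (ω * t))))

section Circle

variable (p : Cover) {τ : ℝ} (h₀ : 0 ≤ τ) (h₁ : τ < 1) (ω : ℝ)

theorem isC1Curve_circleLoop : IsC1Curve (circleLoop p h₀ h₁ ω) := by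
  have hm : ∀ t, 1 + τ ^ 2 - 2 * τ * Real.cos (ω * t) ≠ 0 := fun t => (circle_denom_pos h₀ h₁ _).ne'
  have hc : ∀ t, 1 - τ * Real.cos (ω * t) ≠ 0 := fun t => (circle_cos_pos h₀ h₁ _).ne'
  refine ⟨?_, ?_, ?_⟩
  · change ContDiff ℝ 1 fun t : ℝ => p.1.re - 2 * p.1.im * τ * (1 - τ) / (1 + τ) *
      Real.sin (ω * t) / (1 + τ ^ 2 - 2 * τ * Real.cos (ω * t))
    exact contDiff_const.sub (ContDiff.div (by fun_prop) (by fun_prop) hm)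
  · change ContDiff ℝ 1 fun t : ℝ =>
      p.1.im * (1 - τ) ^ 2 / (1 + τ ^ 2 - 2 * τ * Real.cos (ω * t))
    exact ContDiff.div (by fun_prop) (by fun_prop) hm
  · change ContDiff ℝ 1 fun t : ℝ =>
      p.2 + 2 * Real.arctan (τ * Real.sin (ω * t) / (1 - τ * Real.cos (ω * t)))
    exact contDiff_const.add (contDiff_const.mul (ContDiff.div (by fun_prop) (by fun_prop) hc).arctan)

theorem circleLoop_of_sin_cos {t : ℝ} (hs : Real.sin (ω * t) = 0) (hc : Real.cos (ω * t) = 1) :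
    circleLoop p h₀ h₁ ω t = p := by
  have h2 : 1 - τ ≠ 0 := (sub_pos.2 h₁).ne'
  have h3 : 1 + τ ^ 2 - 2 * τ * 1 = (1 - τ) ^ 2 := by ring
  refine Prod.ext (UpperHalfPlane.ext (Complex.ext ?_ ?_)) ?_
  · change p.1.re - _ = p.1.re
    rw [hs]; simp
  · change p.1.im * (1 - τ) ^ 2 / (1 + τ ^ 2 - 2 * τ * Real.cos (ω * t)) = p.1.im
    rw [hc, h3]; field_simp
  · change p.2 + _ = p.2
    rw [hs]; simp

/-- The value does not depend on t because the curve is an orbit of lifted rotations about the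
centre of the circle, which preserve L. With τ = tanh(r/2), the speed is |ω| sinh r and w = ω (cosh
r - 1). -/
theorem lagrangian_circleLoop (t : ℝ) :
    lagrangian (circleLoop p h₀ h₁ ω t) (velocity (circleLoop p h₀ h₁ ω) t) =
      1 / 2 * ((2 * τ * ω / (1 - τ ^ 2)) ^ 2 + (2 * τ ^ 2 * ω / (1 - τ ^ 2)) ^ 2)
        + 2 * τ ^ 2 * ω / (1 - τ ^ 2) := by
  set s := Real.sin (ω * t) with hs
  set c := Real.cos (ω * t) with hc
  have hsc : s ^ 2 + c ^ 2 = 1 := Real.sin_sq_add_cos_sq _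
  have hm : 0 < 1 + τ ^ 2 - 2 * τ * c := circle_denom_pos h₀ h₁ _
  have hd : 0 < 1 - τ * c := circle_cos_pos h₀ h₁ _
  have hy := p.1.im_pos
  have h1 : 0 < 1 - τ := sub_pos.2 h₁
  have h1' : 0 < 1 - τ ^ 2 := by nlinarith
  have hφ : HasDerivAt (fun t : ℝ => ω * t) ω t := by
    simpa using (hasDerivAt_id t).const_mul ω
  have dm : HasDerivAt (fun t : ℝ => 1 + τ ^ 2 - 2 * τ * Real.cos (ω * t))
      (-(2 * τ * (-s * ω))) t := (hφ.cos.const_mul (2 * τ)).const_sub _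
  have dx : deriv (fun t => (circleLoop p h₀ h₁ ω t).1.re) t =
      -(2 * p.1.im * τ * (1 - τ) / (1 + τ) * ω * (c * (1 + τ ^ 2) - 2 * τ)
        / (1 + τ ^ 2 - 2 * τ * c) ^ 2) := by
    have := ((hφ.sin.const_mul (2 * p.1.im * τ * (1 - τ) / (1 + τ))).div dm hm.ne').const_sub p.1.re
    refine HasDerivAt.deriv (this.congr_deriv ?_)
    rw [← hs, ← hc]
    field_simp
    linear_combination (2 * τ ^ 2 * ω) * hsc
  have dy : deriv (fun t => (circleLoop p h₀ h₁ ω t).1.im) t =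
      -(p.1.im * (1 - τ) ^ 2 * (2 * τ * s * ω) / (1 + τ ^ 2 - 2 * τ * c) ^ 2) := by
    have := (hasDerivAt_const t (p.1.im * (1 - τ) ^ 2)).div dm hm.ne'
    refine HasDerivAt.deriv (this.congr_deriv ?_)
    rw [← hc]
    field_simp
    ring
  have dθ : deriv (fun t => (circleLoop p h₀ h₁ ω t).2) t =
      2 * τ * ω * (c - τ) / (1 + τ ^ 2 - 2 * τ * c) := by
    have := ((((hφ.sin.const_mul τ).div ((hφ.cos.const_mul τ).const_sub 1) hd.ne').arctan.const_mul
      2).const_add p.2)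
    refine HasDerivAt.deriv (this.congr_deriv ?_)
    simp only [Pi.div_apply]
    rw [← hc, ← hs]
    have : 1 + (τ * s / (1 - τ * c)) ^ 2 = (1 + τ ^ 2 - 2 * τ * c) / (1 - τ * c) ^ 2 := by
      field_simp
      linear_combination τ ^ 2 * hsc
    rw [this]
    field_simp
    linear_combination (-(τ ^ 2 * ω)) * hsc
  have hu : deriv (fun t => (circleLoop p h₀ h₁ ω t).1.re) t / (circleLoop p h₀ h₁ ω t).1.im =
      -(2 * τ * ω / (1 - τ ^ 2) * (c * (1 + τ ^ 2) - 2 * τ) / (1 + τ ^ 2 - 2 * τ * c)) := by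
    rw [dx]
    change -_ / (p.1.im * (1 - τ) ^ 2 / (1 + τ ^ 2 - 2 * τ * c)) = _
    have : 1 - τ ^ 2 = (1 - τ) * (1 + τ) := by ring
    rw [this]
    field_simp
  have hv : deriv (fun t => (circleLoop p h₀ h₁ ω t).1.im) t / (circleLoop p h₀ h₁ ω t).1.im =
      -(2 * τ * ω * s / (1 + τ ^ 2 - 2 * τ * c)) := by
    rw [dy]
    change -_ / (p.1.im * (1 - τ) ^ 2 / (1 + τ ^ 2 - 2 * τ * c)) = _
    field_simp
  have hL : ∀ (q : Cover) (v : ℝ × ℝ × ℝ), lagrangian q v = 1 / 2 * ((v.1 / q.1.im) ^ 2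
      + (v.2.1 / q.1.im) ^ 2 + (v.2.2 + v.1 / q.1.im) ^ 2) + (v.2.2 + v.1 / q.1.im) := fun q v => by
    have := q.1.im_pos
    unfold lagrangian
    field_simp
    ring
  have hw : 2 * τ * ω * (c - τ) / (1 + τ ^ 2 - 2 * τ * c)
      + -(2 * τ * ω / (1 - τ ^ 2) * (c * (1 + τ ^ 2) - 2 * τ) / (1 + τ ^ 2 - 2 * τ * c))
      = 2 * τ ^ 2 * ω / (1 - τ ^ 2) := by
    field_simp
    ring
  have huv : (2 * τ * ω / (1 - τ ^ 2) * (c * (1 + τ ^ 2) - 2 * τ) / (1 + τ ^ 2 - 2 * τ * c)) ^ 2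
      + (2 * τ * ω * s / (1 + τ ^ 2 - 2 * τ * c)) ^ 2 = (2 * τ * ω / (1 - τ ^ 2)) ^ 2 := by
    have hs2 : s ^ 2 = 1 - c ^ 2 := by linarith
    rw [div_pow (2 * τ * ω * s), mul_pow (2 * τ * ω) s, hs2]
    field_simp
    ring
  rw [hL]
  simp only [velocity]
  rw [hu, hv, dθ, hw, neg_sq, neg_sq, huv]

end Circle

/-- For every positive time there is a loop in the universal cover with `(L + 1/4)`-action `π`. -/
theorem exists_loop (p : Cover) {T : ℝ} (hT : 0 < T) :
    ∃ γ : ℝ → Cover, IsC1Curve γ ∧ γ 0 = p ∧ γ T = p ∧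
      ∀ k, action k γ T = (Real.pi + (k - 1 / 4) * T : ℝ) := by
  have hπ := Real.pi_pos
  -- For ω = -2π/T this radius, sinh²(r/2) = T/(8π), makes w = -1/2, so that the square (w + 1/2)²
  -- in the excess vanishes.
  obtain ⟨τ, hτ⟩ : ∃ τ, τ = √(T / (T + 8 * Real.pi)) := ⟨_, rfl⟩
  have h₀ : 0 ≤ τ := hτ ▸ Real.sqrt_nonneg _
  have hsq : τ ^ 2 = T / (T + 8 * Real.pi) := by rw [hτ, Real.sq_sqrt (by positivity)]
  have hlt : τ ^ 2 < 1 := by rw [hsq, div_lt_one (by positivity)]; linarith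
  have h₁ : τ < 1 := by nlinarith
  refine ⟨circleLoop p h₀ h₁ (-(2 * Real.pi / T)), isC1Curve_circleLoop _ _ _ _,
    circleLoop_of_sin_cos _ _ _ _ (by simp) (by simp), ?_, fun k => ?_⟩
  · have : -(2 * Real.pi / T) * T = -(2 * Real.pi) := by field_simp
    exact circleLoop_of_sin_cos _ _ _ _ (by rw [this]; simp) (by rw [this]; simp)
  · rw [action_eq k ((isC1Curve_circleLoop _ _ _ _).continuous_lagrangian.intervalIntegrable _ _)]
    have hval : ∀ t, lagrangian (circleLoop p h₀ h₁ (-(2 * Real.pi / T)) t)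
        (velocity (circleLoop p h₀ h₁ (-(2 * Real.pi / T))) t) + 1 / 4 = Real.pi / T := fun t => by
      rw [lagrangian_circleLoop, div_pow, mul_pow, mul_pow, hsq]
      have : 1 - T / (T + 8 * Real.pi) = 8 * Real.pi / (T + 8 * Real.pi) := by
        field_simp; ring
      rw [this]
      field_simp
      ring
    simp_rw [hval]
    rw [intervalIntegral.integral_const]
    congr 1
    simp only [sub_zero, smul_eq_mul]
    field_simp

/-! ### The critical value of the universal cover and the Peierls barrier -/

theorem criticalValue_eq {K : Subgroup (Cover ≃ₜ Cover)} {c : ℝ}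
    (h₁ : ∀ k, c ≤ k → ∀ (T : ℝ) (γ : ℝ → Cover), 0 < T → IsACCurve γ T →
      (∃ φ ∈ K, φ (γ 0) = γ T) → 0 ≤ action k γ T)
    (h₂ : ∀ k < c, ∃ (T : ℝ) (γ : ℝ → Cover), 0 < T ∧ IsACCurve γ T ∧
      (∃ φ ∈ K, φ (γ 0) = γ T) ∧ action k γ T < 0) : criticalValue K = c := by
  have : {k : ℝ | ∀ (T : ℝ) (γ : ℝ → Cover), 0 < T → IsACCurve γ T →
      (∃ φ ∈ K, φ (γ 0) = γ T) → 0 ≤ action k γ T} = Ici c := by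
    ext k
    refine ⟨fun h => ?_, h₁ k⟩
    by_contra hk
    obtain ⟨T, γ, hT, hγ, hφ, hneg⟩ := h₂ k (not_le.1 hk)
    exact (h T γ hT hγ hφ).not_gt hneg
  rw [criticalValue, this, csInf_Ici]

/-- On a closed loop the phase terms cancel, which leaves a nonnegative action for k ≥ 1/4. For k <
1/4 the loops of action π + (k - 1/4)T become negative for large T. -/
theorem cUniversal_eq : cUniversal = 1 / 4 := by
  refine criticalValue_eq (fun k hk T γ hT hγ hφ => ?_) fun k hk => ?_
  · obtain ⟨φ, hφ, hloop⟩ := hφ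
    rw [Subgroup.mem_bot.1 hφ] at hloop
    refine le_action fun hi => ?_
    have h1 := phase_sub_le hγ hi (γ 0) hT.le
    rw [← hloop] at h1
    change phase (γ 0) (γ 0) - _ ≤ _ at h1
    rw [sub_self] at h1
    have := mul_nonneg (sub_nonneg.2 hk) hT.le
    linarith
  · have hk' : 0 < 1 / 4 - k := sub_pos.2 hk
    -- This duration makes the action π + (k - 1/4)T equal to -1.
    have hT : 0 < (Real.pi + 1) / (1 / 4 - k) := div_pos (by positivity) hk'
    obtain ⟨γ, hC, h0, h1, hact⟩ := exists_loop (UpperHalfPlane.I, 0) hT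
    refine ⟨_, γ, hT, hC.isACCurve _, ⟨1, one_mem _, by rw [h0, h1]; rfl⟩, ?_⟩
    rw [hact k]
    have : (k - 1 / 4) * ((Real.pi + 1) / (1 / 4 - k)) = -(Real.pi + 1) := by
      rw [← neg_sub, neg_mul, mul_div_cancel₀ _ hk'.ne']
    rw [this]
    exact EReal.coe_neg'.2 (by linarith)

theorem finiteTimePotential_le {γ : ℝ → Cover} {T : ℝ} {p q : Cover} (h : IsACCurve γ T)
    (h0 : γ 0 = p) (h1 : γ T = q) : finiteTimePotential T p q ≤ action 0 γ T :=
  iInf₂_le γ ⟨h, h0, h1⟩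

theorem le_peierlsBarrier {p q : Cover} {C T₀ : ℝ} (h : ∀ T ≥ T₀, ∀ γ : ℝ → Cover, IsACCurve γ T →
    γ 0 = p → γ T = q → IntervalIntegrable (fun t => lagrangian (γ t) (velocity γ t)) volume 0 T →
    C ≤ ∫ t in (0 : ℝ)..T, (lagrangian (γ t) (velocity γ t) + 1 / 4)) :
    (C : EReal) ≤ peierlsBarrier p q := by
  refine le_liminf_of_le (by isBoundedDefault) ?_
  filter_upwards [eventually_ge_atTop T₀] with T hT
  have h1 : ((C - 1 / 4 * T : ℝ) : EReal) ≤ finiteTimePotential T p q := by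
    refine le_iInf₂ fun γ hγ => le_action fun hi => ?_
    have := h T hT γ hγ.1 hγ.2.1 hγ.2.2 hi
    linarith
  calc (C : EReal) = ((C - 1 / 4 * T : ℝ) : EReal) + ((cUniversal * T : ℝ) : EReal) := by
        rw [← EReal.coe_add, cUniversal_eq]; congr 1; ring
    _ ≤ _ := by gcongr

/-- The extra time S leaves room for a fixed curve appended to a loop of arbitrary duration T. -/
theorem peierlsBarrier_le {p q : Cover} {C S : ℝ}
    (h : ∀ T > 0, finiteTimePotential (T + S) p q ≤ ((C - 1 / 4 * (T + S) : ℝ) : EReal)) :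
    peierlsBarrier p q ≤ C := by
  refine liminf_le_of_frequently_le' (Eventually.frequently ?_)
  filter_upwards [eventually_gt_atTop S] with T hT
  have h1 := h (T - S) (sub_pos.2 hT)
  rw [sub_add_cancel] at h1
  calc finiteTimePotential T p q + ((cUniversal * T : ℝ) : EReal)
      ≤ ((C - 1 / 4 * T : ℝ) : EReal) + ((cUniversal * T : ℝ) : EReal) := by gcongr
    _ = C := by rw [← EReal.coe_add, cUniversal_eq]; congr 1; ring

theorem tendsto_gud_atTop (δ : ℝ) : Tendsto (gud δ) atTop (𝓝 (Real.pi / 2)) :=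
  ((Real.tendsto_arctan_atTop.mono_right nhdsWithin_le_nhds).comp Real.tendsto_sqrt_atTop).comp
    (tendsto_atTop_add_const_left _ δ tendsto_id)

theorem peierlsBarrier_self (p : Cover) : peierlsBarrier p p = (Real.pi : EReal) := by
  refine le_antisymm (peierlsBarrier_le (S := 0) fun T hT => ?_) ?_
  · obtain ⟨γ, hC, h0, h1, hact⟩ := exists_loop p hT
    rw [add_zero]
    refine (finiteTimePotential_le (hC.isACCurve T) h0 h1).trans ?_
    rw [hact 0]
    exact EReal.coe_le_coe_iff.2 (by linarith)
  · refine EReal.ge_of_forall_gt_iff_ge.1 fun C hC => ?_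
    have hC := EReal.coe_lt_coe_iff.1 hC
    -- The two errors of size (π - C)/4, at the centre and at radius R, are chosen so that 2(`gud δ
    -- R` - `gud δ 0`) exceeds C.
    obtain ⟨δ, hδ0, hδ⟩ : ∃ δ > 0, gud δ 0 < (Real.pi - C) / 4 := by
      have h1 : Tendsto (fun δ => gud δ 0) (𝓝[>] 0) (𝓝 0) := by
        have : Continuous fun δ => gud δ 0 := by unfold gud; fun_prop
        have h2 := (this.tendsto 0).mono_left (nhdsWithin_le_nhds (s := Ioi 0))
        simpa [gud] using h2
      obtain ⟨δ, h3, h4⟩ := ((h1.eventually (gt_mem_nhds (show 0 < (Real.pi - C) / 4 by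
        linarith))).and self_mem_nhdsWithin).exists
      exact ⟨δ, h4, h3⟩
    obtain ⟨R, hR, hR0⟩ : ∃ R, Real.pi / 2 - (Real.pi - C) / 4 < gud δ R ∧ 0 ≤ R :=
      (((tendsto_gud_atTop δ).eventually (lt_mem_nhds (by linarith))).and
        (eventually_ge_atTop 0)).exists
    -- From this time on, a loop that stays within radius R already pays at least π.
    refine le_peierlsBarrier (T₀ := 8 * (1 + R) * Real.pi) fun T hT γ hγ h0 h1 hi => ?_
    have hTpos : 0 ≤ T := le_trans (by have := Real.pi_pos; positivity) hT
    refine le_trans (le_min ?_ ?_) (loop_bound hγ hi hTpos (h0.trans h1.symm) hδ0 R)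
    · refine hC.le.trans ?_
      rw [le_div_iff₀ (by positivity)]
      linarith
    · linarith

/-- Above: loops at p of action π and any duration, followed by `connect p q`. Below: the increment
of the subsolution `phase p` does not depend on T. -/
theorem peierlsBarrier_finite (p q : Cover) :
    peierlsBarrier p q ≠ ⊤ ∧ peierlsBarrier p q ≠ ⊥ := by
  constructor
  · have hc := isC1Curve_connect p q
    have ha := action_eq 0 (hc.continuous_lagrangian.intervalIntegrable 0 1)
    set A := ∫ t in (0 : ℝ)..1, (lagrangian (connect p q t) (velocity (connect p q) t) + 1 / 4)
    refine ne_top_of_le_ne_top (EReal.coe_ne_top (Real.pi + A)) (peierlsBarrier_le (S := 1)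
      fun T hT => ?_)
    obtain ⟨γ, hC, h0, h1, hact⟩ := exists_loop p hT
    have hglue : γ T = connect p q 0 := by rw [h1, connect_zero]
    refine (finiteTimePotential_le (isACCurve_concat hC hc hT.le zero_le_one hglue) ?_ ?_).trans ?_
    · rw [concat, if_pos hT.le, h0]
    · rw [concat, if_neg (by linarith), add_sub_cancel_left, connect_one]
    · rw [action_concat hC hc hT.le zero_le_one, hact, ha, ← EReal.coe_add]
      exact EReal.coe_le_coe_iff.2 (by linarith)
  · refine ne_bot_of_le_ne_bot (EReal.coe_ne_bot (phase p q - phase p p))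
      (le_peierlsBarrier (T₀ := 0) fun T hT γ hγ h0 h1 hi => ?_)
    have := phase_sub_le hγ hi p hT
    rwa [h0, h1] at this

theorem aubrySet_eq_empty : aubrySet = ∅ := by
  refine eq_empty_of_forall_notMem fun p hp => ?_
  have h : peierlsBarrier p p = 0 := hp
  rw [peierlsBarrier_self] at h
  exact Real.pi_pos.ne' (EReal.coe_eq_zero.1 h)

/-! ### The covering of `PSL(2, ℝ)` -/

theorem mk_eq_of_eq_or_eq_neg {g h : SL(2, ℝ)} (H : h = g ∨ h = -g) : (g : PSL2R) = (h : PSL2R) := by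
  rw [QuotientGroup.eq, Matrix.SpecialLinearGroup.mem_center_iff]
  rcases H with rfl | rfl
  · exact ⟨1, by simp, by simp⟩
  · refine ⟨-1, by simp, ?_⟩
    have : g⁻¹ * -g = -1 := by rw [mul_neg, inv_mul_cancel]
    rw [this]
    ext i j
    simp only [Matrix.scalar_apply, Matrix.diagonal_apply, Matrix.SpecialLinearGroup.coe_neg,
      Matrix.neg_apply, Matrix.SpecialLinearGroup.coe_one, Matrix.one_apply]
    split_ifs <;> simp

theorem eq_or_eq_neg_of_mk_eq {g h : SL(2, ℝ)} (H : (g : PSL2R) = (h : PSL2R)) :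
    h = g ∨ h = -g := by
  rw [QuotientGroup.eq, Matrix.SpecialLinearGroup.mem_center_iff] at H
  obtain ⟨r, hr, hs⟩ := H
  have hr' : r ^ 2 = 1 := by simpa using hr
  rcases mul_self_eq_one_iff.1 ((sq r).symm.trans hr') with rfl | rfl
  · left
    have : g⁻¹ * h = 1 := by ext i j; rw [← hs]; simp
    rw [inv_mul_eq_one] at this
    exact this.symm
  · right
    have : g⁻¹ * h = -1 := by
      ext i j
      rw [← hs]
      simp only [Matrix.scalar_apply, Matrix.diagonal_apply, Matrix.SpecialLinearGroup.coe_neg,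
        Matrix.neg_apply, Matrix.SpecialLinearGroup.coe_one, Matrix.one_apply]
      split_ifs <;> simp
    rw [inv_mul_eq_iff_eq_mul] at this
    rw [this]; simp

theorem toSL_apply_one_zero (q : Cover) : toSL q 1 0 = -Real.sin (q.2 / 2) / √q.1.im := by
  simp [toSL]; ring

theorem toSL_apply_one_one (q : Cover) : toSL q 1 1 = Real.cos (q.2 / 2) / √q.1.im := by
  simp [toSL]; ring

theorem toSL_apply_zero_zero (q : Cover) : toSL q 0 0 =
    √q.1.im * Real.cos (q.2 / 2) - q.1.re / √q.1.im * Real.sin (q.2 / 2) := by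
  simp [toSL]; ring

theorem toSL_apply_zero_one (q : Cover) : toSL q 0 1 =
    √q.1.im * Real.sin (q.2 / 2) + q.1.re / √q.1.im * Real.cos (q.2 / 2) := by
  simp [toSL]

theorem continuous_toSL : Continuous toSL := by
  refine Continuous.subtype_mk (Continuous.mul ?_ ?_) _
  · refine continuous_matrix fun i j => ?_
    have h : ∀ q : Cover, √q.1.im ≠ 0 := fun q => (Real.sqrt_pos.2 q.1.im_pos).ne'
    have hs : Continuous fun q : Cover => √q.1.im := by fun_prop
    have hx : Continuous fun q : Cover => q.1.re := by fun_prop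
    fin_cases i <;> fin_cases j
    · exact hs
    · exact hx.div hs h
    · exact continuous_const
    · exact continuous_const.div hs h
  · refine continuous_matrix fun i j => ?_
    fin_cases i <;> fin_cases j <;> simp <;> fun_prop

/-- The denominator of the Möbius map of `g`. -/
def den (g : SL(2, ℝ)) (z : UpperHalfPlane) : ℂ := (g 1 0 : ℂ) * z + g 1 1

theorem den_re (g : SL(2, ℝ)) (z : UpperHalfPlane) : (den g z).re = g 1 0 * z.re + g 1 1 := by
  simp [den]

theorem den_im (g : SL(2, ℝ)) (z : UpperHalfPlane) : (den g z).im = g 1 0 * z.im := by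
  simp [den]

theorem den_ne_zero (g : SL(2, ℝ)) (z : UpperHalfPlane) : den g z ≠ 0 :=
  UpperHalfPlane.denom_ne_zero g z

theorem det_eq (g : SL(2, ℝ)) : g 0 0 * g 1 1 - g 0 1 * g 1 0 = 1 := by
  have := g.det_coe
  rwa [Matrix.det_fin_two] at this

theorem coe_smul_eq (g : SL(2, ℝ)) (z : UpperHalfPlane) :
    ((g • z : UpperHalfPlane) : ℂ) = ((g 0 0 : ℂ) * z + g 0 1) / den g z :=
  congrArg UpperHalfPlane.coe (UpperHalfPlane.specialLinearGroup_apply g z)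

theorem neg_smul_eq (g : SL(2, ℝ)) (z : UpperHalfPlane) : (-g) • z = g • z := by
  ext1
  rw [coe_smul_eq, coe_smul_eq, den, den, ← neg_div_neg_eq]
  congr 1 <;> simp <;> ring

theorem smul_mul_den (g : SL(2, ℝ)) (z : UpperHalfPlane) :
    ((g • z : UpperHalfPlane) : ℂ) * den g z = (g 0 0 : ℂ) * z + g 0 1 := by
  rw [coe_smul_eq, div_mul_cancel₀ _ (den_ne_zero g z)]

theorem smul_eq_of {g : SL(2, ℝ)} {z w : UpperHalfPlane}
    (h : (w : ℂ) * den g z = (g 0 0 : ℂ) * z + g 0 1) : g • z = w := by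
  ext1
  rw [coe_smul_eq, ← h, mul_div_cancel_right₀ _ (den_ne_zero g z)]

theorem toSL_smul_I (q : Cover) : toSL q • UpperHalfPlane.I = q.1 := by
  have h : √q.1.im ≠ 0 := (Real.sqrt_pos.2 q.1.im_pos).ne'
  have h2 : √q.1.im ^ 2 = q.1.im := Real.sq_sqrt q.1.im_pos.le
  refine smul_eq_of ?_
  rw [den, toSL_apply_one_zero, toSL_apply_one_one, toSL_apply_zero_zero, toSL_apply_zero_one]
  apply Complex.ext
  · simp
    field_simp
    rw [h2]; ring
  · simp
    field_simp
    rw [h2]; ring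

theorem eq_one_or_neg_one_of_fix {N : SL(2, ℝ)} {z : UpperHalfPlane} (h0 : N 1 0 = 0)
    (hz : N • z = z) : N = 1 ∨ N = -1 := by
  have h1 := smul_mul_den N z
  rw [hz] at h1
  have hre := congrArg Complex.re h1
  have him := congrArg Complex.im h1
  simp [den, h0] at hre him
  have hd := det_eq N
  rw [h0, mul_zero, sub_zero] at hd
  have hz := z.im_pos
  have h3 : N 1 1 = N 0 0 := by
    have := mul_right_cancel₀ hz.ne' ((mul_comm _ _).trans him); exact this
  have h4 : N 0 1 = 0 := by rw [h3] at hre; linarith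
  rw [h3] at hd
  rcases mul_self_eq_one_iff.1 hd with h | h
  · left; ext i j; fin_cases i <;> fin_cases j <;> simp [h0, h3, h4, h]
  · right; ext i j; fin_cases i <;> fin_cases j <;> simp [h0, h3, h4, h]

/-- The second hypothesis says that the bottom rows of g and `toSL q` are proportional, so g (toSL
q)⁻¹ is upper triangular. It also fixes `q.1`, hence is ±1. -/
theorem mk_toSL_eq {q : Cover} {g : SL(2, ℝ)} (h1 : g • UpperHalfPlane.I = q.1)
    (h2 : g 1 0 * Real.cos (q.2 / 2) + g 1 1 * Real.sin (q.2 / 2) = 0) :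
    (toSL q : PSL2R) = (g : PSL2R) := by
  have hq : (toSL q)⁻¹ • q.1 = UpperHalfPlane.I := by
    rw [inv_smul_eq_iff, toSL_smul_I]
  have h0 : (g * (toSL q)⁻¹) 1 0 = 0 := by
    have : (g * (toSL q)⁻¹) 1 0 = g 1 0 * toSL q 1 1 - g 1 1 * toSL q 1 0 := by
      rw [Matrix.SpecialLinearGroup.coe_mul, Matrix.SpecialLinearGroup.coe_inv,
        Matrix.adjugate_fin_two]
      simp [Matrix.mul_apply, Fin.sum_univ_two]
      ring
    rw [this, toSL_apply_one_one, toSL_apply_one_zero]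
    linear_combination h2 / √q.1.im
  rcases eq_one_or_neg_one_of_fix h0 (z := q.1) (by rw [mul_smul, hq, h1]) with h | h
  · exact mk_eq_of_eq_or_eq_neg (Or.inl (mul_inv_eq_one.1 h))
  · refine mk_eq_of_eq_or_eq_neg (Or.inr ?_)
    rw [mul_inv_eq_iff_eq_mul] at h
    rw [h]; simp

theorem eq_of_mk_toSL_eq {p q : Cover} (h : (toSL p : PSL2R) = (toSL q : PSL2R)) :
    p.1 = q.1 ∧ ∃ n : ℤ, p.2 - q.2 = n * (2 * Real.pi) := by
  have key : ∃ ε : ℝ, ε ^ 2 = 1 ∧ toSL q 1 0 = ε * toSL p 1 0 ∧ toSL q 1 1 = ε * toSL p 1 1 ∧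
      p.1 = q.1 := by
    rcases eq_or_eq_neg_of_mk_eq h with h | h
    · exact ⟨1, by simp, by simp [h], by simp [h], by rw [← toSL_smul_I p, ← toSL_smul_I q, h]⟩
    · refine ⟨-1, by simp, by simp [h], by simp [h], ?_⟩
      rw [← toSL_smul_I p, ← toSL_smul_I q, h, neg_smul_eq]
  obtain ⟨ε, hε, hs, hc, h1⟩ := key
  refine ⟨h1, ?_⟩
  have hy : √q.1.im ≠ 0 := (Real.sqrt_pos.2 q.1.im_pos).ne'
  rw [toSL_apply_one_zero, toSL_apply_one_zero, h1] at hs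
  rw [toSL_apply_one_one, toSL_apply_one_one, h1] at hc
  have hs' : Real.sin (q.2 / 2) = ε * Real.sin (p.2 / 2) := by
    field_simp at hs; linarith
  have hc' : Real.cos (q.2 / 2) = ε * Real.cos (p.2 / 2) := by
    field_simp at hc; linarith
  have hcos : Real.cos (p.2 - q.2) = 1 := by
    have e : p.2 - q.2 = 2 * (p.2 / 2 - q.2 / 2) := by ring
    rw [e, Real.cos_two_mul, Real.cos_sub, hs', hc']
    have := Real.sin_sq_add_cos_sq (p.2 / 2)
    have e2 : Real.cos (p.2 / 2) * (ε * Real.cos (p.2 / 2))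
        + Real.sin (p.2 / 2) * (ε * Real.sin (p.2 / 2)) = ε := by
      linear_combination ε * this
    rw [e2, hε]; norm_num
  obtain ⟨n, hn⟩ := (Real.cos_eq_one_iff _).1 hcos
  exact ⟨n, hn.symm⟩

theorem mk_toSL_shift (q : Cover) (n : ℤ) :
    (toSL (q.1, q.2 + n * (2 * Real.pi)) : PSL2R) = (toSL q : PSL2R) := by
  refine mk_toSL_eq (toSL_smul_I q) ?_
  rw [toSL_apply_one_zero, toSL_apply_one_one]
  have h : Real.sin ((q.2 + n * (2 * Real.pi)) / 2 - q.2 / 2) = 0 := by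
    have : (q.2 + n * (2 * Real.pi)) / 2 - q.2 / 2 = n * Real.pi := by ring
    rw [this, Real.sin_int_mul_pi]
  rw [Real.sin_sub] at h
  linear_combination h / √q.1.im

/-- Two continuous maps into the universal cover that have the same projection to `PSL(2, ℝ)` and
agree at a point are equal. -/
theorem eq_of_mk_toSL_comp_eq {X : Type*} [TopologicalSpace X] [PreconnectedSpace X]
    {u v : X → Cover} (hu : Continuous u) (hv : Continuous v)
    (h : ∀ x, (toSL (u x) : PSL2R) = (toSL (v x) : PSL2R)) {x₀ : X} (h₀ : u x₀ = v x₀) : u = v := by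
  -- The difference of the angles, divided by 2π, is a continuous integer valued function on a
  -- connected space.
  choose n hn using fun x => (eq_of_mk_toSL_eq (h x)).2
  have hcont : Continuous n := by
    rw [Int.isClosedEmbedding_coe_real.continuous_iff]
    have : (fun x => (n x : ℝ)) = fun x => ((u x).2 - (v x).2) / (2 * Real.pi) := by
      ext x
      rw [hn x, mul_div_cancel_right₀ _ Real.two_pi_pos.ne']
    change Continuous fun x => (n x : ℝ)
    rw [this]
    fun_prop
  have h0 : n x₀ = 0 := by
    have := hn x₀
    rw [h₀, sub_self] at this
    have h2 : (n x₀ : ℝ) = 0 := by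
      rcases mul_eq_zero.1 this.symm with h | h
      · exact h
      · exact absurd h Real.two_pi_pos.ne'
    exact_mod_cast h2
  ext1 x
  refine Prod.ext (eq_of_mk_toSL_eq (h x)).1 ?_
  have h1 := hn x
  rw [PreconnectedSpace.constant inferInstance hcont (y := x₀), h0] at h1
  simp at h1
  linarith

/-! ### Lifts of Möbius maps -/

/-- The denominator never crosses the branch cut: its imaginary part has the constant sign of `g 1
0`, and if this entry vanishes the denominator is a constant. This gives a globally continuous angle
for the lift of g. -/
theorem continuous_arg_den (g : SL(2, ℝ)) : Continuous fun z => Complex.arg (den g z) := by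
  by_cases hc : g 1 0 = 0
  · simp only [den, hc]
    simp only [Complex.ofReal_zero, zero_mul, zero_add]
    exact continuous_const
  · refine continuous_iff_continuousAt.2 fun z => ?_
    have h : den g z ∈ Complex.slitPlane :=
      Or.inr (by rw [den_im]; exact mul_ne_zero hc z.im_pos.ne')
    have hd : Continuous (den g) := by unfold den; fun_prop
    exact (Complex.continuousAt_arg h).comp hd.continuousAt

/-- A lift to the universal cover of the action of `g` on the unit sphere bundle. -/
def lift (g : SL(2, ℝ)) : Cover ≃ₜ Cover where
  toFun q := (g • q.1, q.2 - 2 * Complex.arg (den g q.1))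
  invFun q := (g⁻¹ • q.1, q.2 + 2 * Complex.arg (den g (g⁻¹ • q.1)))
  left_inv q := by simp
  right_inv q := by simp
  continuous_toFun := ((continuous_const_smul g).comp continuous_fst).prodMk
    (continuous_snd.sub (continuous_const.mul ((continuous_arg_den g).comp continuous_fst)))
  continuous_invFun := ((continuous_const_smul g⁻¹).comp continuous_fst).prodMk
    (continuous_snd.add (continuous_const.mul ((continuous_arg_den g).comp
      ((continuous_const_smul g⁻¹).comp continuous_fst))))

theorem lift_apply (g : SL(2, ℝ)) (q : Cover) :
    lift g q = (g • q.1, q.2 - 2 * Complex.arg (den g q.1)) := rfl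

/-- The Möbius map has derivative `den`⁻², so it turns tangent vectors by -2 arg `den`. -/
theorem mk_toSL_lift (g : SL(2, ℝ)) (q : Cover) :
    (toSL (lift g q) : PSL2R) = ((g * toSL q : SL(2, ℝ)) : PSL2R) := by
  refine mk_toSL_eq (by rw [mul_smul, toSL_smul_I]; rfl) ?_
  have hy : √q.1.im ≠ 0 := (Real.sqrt_pos.2 q.1.im_pos).ne'
  have h2 : √q.1.im ^ 2 = q.1.im := Real.sq_sqrt q.1.im_pos.le
  have h1 : ∀ j, (g * toSL q) 1 j = g 1 0 * toSL q 0 j + g 1 1 * toSL q 1 j := fun j => by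
    simp [Matrix.mul_apply, Fin.sum_univ_two]
  rw [h1, h1, toSL_apply_one_zero, toSL_apply_one_one, toSL_apply_zero_zero, toSL_apply_zero_one]
  have e : (lift g q).2 / 2 = q.2 / 2 - Complex.arg (den g q.1) := by
    rw [lift_apply]; dsimp only; ring
  rw [e, Real.cos_sub, Real.sin_sub]
  have hre := Complex.norm_mul_cos_arg (den g q.1)
  have him := Complex.norm_mul_sin_arg (den g q.1)
  rw [den_re] at hre
  rw [den_im] at him
  have hpol : g 1 0 * q.1.im * Real.cos (Complex.arg (den g q.1))
      - (g 1 0 * q.1.re + g 1 1) * Real.sin (Complex.arg (den g q.1)) = 0 := by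
    rw [← hre, ← him]; ring
  have hsc := Real.sin_sq_add_cos_sq (q.2 / 2)
  field_simp
  rw [h2]
  linear_combination (Real.sin (q.2 / 2) ^ 2 + Real.cos (q.2 / 2) ^ 2) * hpol

/-- Translation of the fibre coordinate. -/
def shift (t : ℝ) : Cover ≃ₜ Cover where
  toFun q := (q.1, q.2 + t)
  invFun q := (q.1, q.2 - t)
  left_inv q := by simp
  right_inv q := by simp

theorem shift_apply (t : ℝ) (q : Cover) : shift t q = (q.1, q.2 + t) := rfl

theorem mk_toSL_shift_int (q : Cover) (n : ℤ) :
    (toSL (shift (n * (2 * Real.pi)) q) : PSL2R) = (toSL q : PSL2R) := mk_toSL_shift q n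

section Deck

variable {Γ : Subgroup PSL2R}

theorem proj_eq_iff {p q : Cover} :
    proj Γ p = proj Γ q ↔ (toSL p : PSL2R) * (toSL q : PSL2R)⁻¹ ∈ Γ := by
  rw [eq_comm]
  unfold proj
  rw [Quotient.eq, QuotientGroup.rightRel_apply]

theorem lift_mem_deckGroup {g : SL(2, ℝ)} (hg : (g : PSL2R) ∈ Γ) : lift g ∈ deckGroup Γ := by
  intro q
  rw [proj_eq_iff, mk_toSL_lift]
  simpa using hg

theorem shift_mem_deckGroup (n : ℤ) : shift (n * (2 * Real.pi)) ∈ deckGroup Γ := by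
  intro q
  rw [proj_eq_iff, mk_toSL_shift_int]
  simp

/-- The element of Γ relating φ q to q depends continuously on q; since the cover is connected and Γ
discrete, it is constant. -/
theorem exists_mk_toSL_deck [DiscreteTopology Γ] {φ : Cover ≃ₜ Cover} (hφ : φ ∈ deckGroup Γ) :
    ∃ γ ∈ Γ, ∀ q, (toSL (φ q) : PSL2R) = γ * (toSL q : PSL2R) := by
  have hmem : ∀ q, (toSL (φ q) : PSL2R) * (toSL q : PSL2R)⁻¹ ∈ Γ := fun q => proj_eq_iff.1 (hφ q)
  have hmk : Continuous fun g : SL(2, ℝ) => (g : PSL2R) := continuous_quot_mk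
  have hc : Continuous fun q => (⟨_, hmem q⟩ : Γ) := by
    refine Continuous.subtype_mk ?_ _
    exact (hmk.comp (continuous_toSL.comp φ.continuous)).mul (hmk.comp continuous_toSL).inv
  refine ⟨_, hmem (UpperHalfPlane.I, 0), fun q => ?_⟩
  have := congrArg Subtype.val
    (PreconnectedSpace.constant inferInstance hc (x := q) (y := (UpperHalfPlane.I, 0)))
  exact mul_inv_eq_iff_eq_mul.1 this

/-- Deck transformations over the same element of `Γ` differ by a translation in the fibre. -/
theorem eq_shift_lift {φ : Cover ≃ₜ Cover} {g : SL(2, ℝ)}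
    (h : ∀ q, (toSL (φ q) : PSL2R) = (g : PSL2R) * (toSL q : PSL2R)) :
    ∃ n : ℤ, φ = shift (n * (2 * Real.pi)) * lift g := by
  have hl : ∀ q, (toSL (lift g q) : PSL2R) = (g : PSL2R) * (toSL q : PSL2R) := mk_toSL_lift g
  obtain ⟨h1, n, hn⟩ := eq_of_mk_toSL_eq ((h (UpperHalfPlane.I, 0)).trans (hl _).symm)
  refine ⟨n, Homeomorph.ext (congrFun (eq_of_mk_toSL_comp_eq (x₀ := (UpperHalfPlane.I, 0))
    φ.continuous (shift (n * (2 * Real.pi)) * lift g).continuous (fun q => ?_) ?_))⟩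
  · exact (h q).trans ((hl q).symm.trans (mk_toSL_shift_int _ n).symm)
  · exact Prod.ext h1 (by change _ = (lift g (UpperHalfPlane.I, 0)).2 + _; linarith)

theorem exists_eq_shift_lift [DiscreteTopology Γ] {φ : Cover ≃ₜ Cover} (hφ : φ ∈ deckGroup Γ) :
    ∃ g : SL(2, ℝ), (g : PSL2R) ∈ Γ ∧ ∃ n : ℤ, φ = shift (n * (2 * Real.pi)) * lift g := by
  obtain ⟨γ, hγ, h⟩ := exists_mk_toSL_deck hφ
  obtain ⟨g, rfl⟩ := QuotientGroup.mk_surjective γ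
  exact ⟨g, hγ, eq_shift_lift h⟩

end Deck

/-! ### Invariance of the Lagrangian -/

theorem hasDerivAt_coe {γ : ℝ → Cover} {t : ℝ} (h : CurveDifferentiableAt γ t) :
    HasDerivAt (fun s => ((γ s).1 : ℂ)) ((velocity γ t).1 + (velocity γ t).2.1 * Complex.I) t := by
  have := (h.1.hasDerivAt.ofReal_comp).add ((h.2.1.hasDerivAt.ofReal_comp).mul_const Complex.I)
  refine this.congr_of_eventuallyEq (Eventually.of_forall fun s => ?_)
  exact (Complex.re_add_im ((γ s).1 : ℂ)).symm

theorem hasDerivAt_smul (g : SL(2, ℝ)) {γ : ℝ → Cover} {t : ℝ} (h : CurveDifferentiableAt γ t) :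
    HasDerivAt (fun s => ((g • (γ s).1 : UpperHalfPlane) : ℂ))
      (((velocity γ t).1 + (velocity γ t).2.1 * Complex.I) / den g (γ t).1 ^ 2) t := by
  have hz := hasDerivAt_coe h
  have hd := den_ne_zero g (γ t).1
  have := ((hz.const_mul (g 0 0 : ℂ)).add_const (g 0 1 : ℂ)).div
    ((hz.const_mul (g 1 0 : ℂ)).add_const (g 1 1 : ℂ)) hd
  have h2 : HasDerivAt (fun s => ((g • (γ s).1 : UpperHalfPlane) : ℂ)) _ t :=
    this.congr_of_eventuallyEq (Eventually.of_forall fun s => coe_smul_eq g (γ s).1)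
  refine h2.congr_deriv ?_
  have hdet : (g 0 0 : ℂ) * g 1 1 - g 0 1 * g 1 0 = 1 := by exact_mod_cast det_eq g
  congr 1
  linear_combination ((velocity γ t).1 + (velocity γ t).2.1 * Complex.I) * hdet

theorem hasDerivAt_arg_den (g : SL(2, ℝ)) {γ : ℝ → Cover} {t : ℝ}
    (h : CurveDifferentiableAt γ t) :
    HasDerivAt (fun s => Complex.arg (den g (γ s).1))
      ((g 1 0 : ℂ) * ((velocity γ t).1 + (velocity γ t).2.1 * Complex.I) / den g (γ t).1).im t := by
  by_cases hc : g 1 0 = 0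
  · simp only [den, hc, Complex.ofReal_zero, zero_mul, zero_add, zero_div, Complex.zero_im]
    exact hasDerivAt_const _ _
  · have hs : den g (γ t).1 ∈ Complex.slitPlane :=
      Or.inr (by rw [den_im]; exact mul_ne_zero hc (γ t).1.im_pos.ne')
    have hd : HasDerivAt (fun s => den g (γ s).1) _ t :=
      ((hasDerivAt_coe h).const_mul (g 1 0 : ℂ)).add_const (g 1 1 : ℂ)
    have := Complex.imCLM.hasFDerivAt.comp_hasDerivAt t (hd.clog_real hs)
    exact this.congr_of_eventuallyEq (Eventually.of_forall fun s => (Complex.log_im _).symm)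

theorem div_sq_re_im (p q P Q : ℝ) (h : 0 < P ^ 2 + Q ^ 2) :
    ((p + q * Complex.I) / (P + Q * Complex.I) ^ 2).re
        = (p * (P ^ 2 - Q ^ 2) + 2 * q * P * Q) / (P ^ 2 + Q ^ 2) ^ 2 ∧
      ((p + q * Complex.I) / (P + Q * Complex.I) ^ 2).im
        = (q * (P ^ 2 - Q ^ 2) - 2 * p * P * Q) / (P ^ 2 + Q ^ 2) ^ 2 := by
  have hn : ((P : ℂ) + Q * Complex.I) * (P - Q * Complex.I) = ((P ^ 2 + Q ^ 2 : ℝ) : ℂ) := by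
    push_cast
    linear_combination (-(Q : ℂ) ^ 2) * Complex.I_sq
  have hm : ((P ^ 2 + Q ^ 2 : ℝ) : ℂ) ≠ 0 := Complex.ofReal_ne_zero.2 h.ne'
  have hne : (P : ℂ) + Q * Complex.I ≠ 0 := left_ne_zero_of_mul (hn ▸ hm)
  have e : ((p : ℂ) + q * Complex.I) / (P + Q * Complex.I) ^ 2
      = (p + q * Complex.I) * (P - Q * Complex.I) ^ 2 / (((P ^ 2 + Q ^ 2) ^ 2 : ℝ) : ℂ) := by
    rw [div_eq_div_iff (pow_ne_zero 2 hne) (by push_cast at hm ⊢; exact pow_ne_zero 2 hm),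
      Complex.ofReal_pow, ← hn]
    ring
  rw [e, Complex.div_ofReal_re, Complex.div_ofReal_im]
  constructor
  · congr 1
    simp [pow_two]
    ring
  · congr 1
    simp [pow_two]
    ring

theorem lagrangian_lift_aux {p q w P Q y : ℝ} (hy : 0 < y) (h : 0 < P ^ 2 + Q ^ 2) :
    1 / (2 * (y / (P ^ 2 + Q ^ 2)) ^ 2) *
        (((p * (P ^ 2 - Q ^ 2) + 2 * q * P * Q) / (P ^ 2 + Q ^ 2) ^ 2) ^ 2
          + ((q * (P ^ 2 - Q ^ 2) - 2 * p * P * Q) / (P ^ 2 + Q ^ 2) ^ 2) ^ 2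
          + (y / (P ^ 2 + Q ^ 2) * (w - 2 * (Q * (q * P - p * Q) / (y * (P ^ 2 + Q ^ 2))))
            + (p * (P ^ 2 - Q ^ 2) + 2 * q * P * Q) / (P ^ 2 + Q ^ 2) ^ 2) ^ 2)
        + (w - 2 * (Q * (q * P - p * Q) / (y * (P ^ 2 + Q ^ 2))))
        + (p * (P ^ 2 - Q ^ 2) + 2 * q * P * Q) / (P ^ 2 + Q ^ 2) ^ 2 / (y / (P ^ 2 + Q ^ 2))
      = 1 / (2 * y ^ 2) * (p ^ 2 + q ^ 2 + (y * w + p) ^ 2) + w + p / y := by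
  field_simp
  ring

/-- The base part is the hyperbolic metric. In the fibre, the derivative of -2 arg `den` compensates
exactly the change of ẋ/y, so the connection form is invariant as well. -/
theorem lagrangian_lift (g : SL(2, ℝ)) (r : ℝ) {γ : ℝ → Cover} {t : ℝ}
    (h : CurveDifferentiableAt γ t) :
    CurveDifferentiableAt (fun s => shift r (lift g (γ s))) t ∧
      lagrangian (shift r (lift g (γ t))) (velocity (fun s => shift r (lift g (γ s))) t)
        = lagrangian (γ t) (velocity γ t) := by
  have hz := hasDerivAt_smul g h
  have hx := Complex.reCLM.hasFDerivAt.comp_hasDerivAt t hz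
  have hy := Complex.imCLM.hasFDerivAt.comp_hasDerivAt t hz
  have hθ := ((h.2.2.hasDerivAt).sub ((hasDerivAt_arg_den g h).const_mul 2)).add_const r
  have hx' : HasDerivAt (fun s => (shift r (lift g (γ s))).1.re) _ t := hx
  have hy' : HasDerivAt (fun s => (shift r (lift g (γ s))).1.im) _ t := hy
  have hθ' : HasDerivAt (fun s => (shift r (lift g (γ s))).2) _ t := hθ
  refine ⟨⟨hx'.differentiableAt, hy'.differentiableAt, hθ'.differentiableAt⟩, ?_⟩
  have hv : velocity (fun s => shift r (lift g (γ s))) t = (_, _, _) :=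
    Prod.ext hx'.deriv (Prod.ext hy'.deriv hθ'.deriv)
  rw [hv]
  have him : (shift r (lift g (γ t))).1.im = (γ t).1.im / Complex.normSq (den g (γ t).1) :=
    UpperHalfPlane.im_smul_eq_div_normSq g (γ t).1 |>.trans (by simp [den, UpperHalfPlane.denom])
  have h3 : deriv (fun s => (γ s).2) t = (velocity γ t).2.2 := rfl
  rw [h3]
  generalize velocity γ t = v
  obtain ⟨p, q, w⟩ := v
  have hpos : 0 < Complex.normSq (den g (γ t).1) := Complex.normSq_pos.2 (den_ne_zero g _)
  unfold lagrangian
  rw [him]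
  have hyp := (γ t).1.im_pos
  obtain ⟨P, hP⟩ : ∃ P, P = (den g (γ t).1).re := ⟨_, rfl⟩
  obtain ⟨Q, hQ⟩ : ∃ Q, Q = (den g (γ t).1).im := ⟨_, rfl⟩
  have hc : g 1 0 = Q / (γ t).1.im := by
    rw [hQ, den_im, mul_div_cancel_right₀ _ hyp.ne']
  have hden : den g (γ t).1 = P + Q * Complex.I := by
    rw [hP, hQ, Complex.re_add_im]
  have hn : Complex.normSq (den g (γ t).1) = P ^ 2 + Q ^ 2 := by
    rw [hden, Complex.normSq_add_mul_I]
  rw [hn] at hpos ⊢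
  have e2 : ((g 1 0 : ℂ) * (p + q * Complex.I) / den g (γ t).1).im
      = Q * (q * P - p * Q) / ((γ t).1.im * (P ^ 2 + Q ^ 2)) := by
    rw [Complex.div_im, hn, ← hP, ← hQ, hc]
    simp only [Complex.mul_re, Complex.mul_im, Complex.add_re, Complex.add_im, Complex.ofReal_re,
      Complex.ofReal_im, Complex.I_re, Complex.I_im]
    field_simp
    ring
  simp only [Complex.reCLM_apply, Complex.imCLM_apply]
  rw [e2, hden, (div_sq_re_im p q P Q hpos).1, (div_sq_re_im p q P Q hpos).2]
  exact lagrangian_lift_aux hyp hpos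

/-- The Lagrangian is invariant under deck transformations. -/
theorem lagrangian_deck {Γ : Subgroup PSL2R} [DiscreteTopology Γ] {φ : Cover ≃ₜ Cover}
    (hφ : φ ∈ deckGroup Γ) {γ : ℝ → Cover} {t : ℝ} (h : CurveDifferentiableAt γ t) :
    CurveDifferentiableAt (fun s => φ (γ s)) t ∧
      lagrangian (φ (γ t)) (velocity (fun s => φ (γ s)) t) = lagrangian (γ t) (velocity γ t) := by
  obtain ⟨g, -, n, rfl⟩ := exists_eq_shift_lift hφ
  exact lagrangian_lift g _ h

/-! ### The geodesic flow on the universal cover -/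

/-- The diagonal one-parameter group. -/
def diagSL (s : ℝ) : SL(2, ℝ) :=
  ⟨!![Real.exp s, 0; 0, Real.exp (-s)], by
    rw [Matrix.det_fin_two_of, ← Real.exp_add]; simp⟩

/-- The group of rotations, parametrised by the rotation angle on tangent vectors. -/
def rotSL (t : ℝ) : SL(2, ℝ) :=
  ⟨!![Real.cos (t / 2), Real.sin (t / 2); -Real.sin (t / 2), Real.cos (t / 2)], by
    rw [Matrix.det_fin_two_of]; linear_combination Real.sin_sq_add_cos_sq (t / 2)⟩

theorem SL_mul_apply (g h : SL(2, ℝ)) (i j : Fin 2) :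
    (g * h) i j = g i 0 * h 0 j + g i 1 * h 1 j := by
  simp [Matrix.mul_apply, Fin.sum_univ_two]

theorem mk_toSL_shift_eq (t : ℝ) (q : Cover) :
    (toSL (shift t q) : PSL2R) = ((toSL q * rotSL t : SL(2, ℝ)) : PSL2R) := by
  have hk : rotSL t • UpperHalfPlane.I = UpperHalfPlane.I := by
    refine smul_eq_of (Complex.ext ?_ ?_) <;> simp [den, rotSL, -Complex.ofReal_cos, -Complex.ofReal_sin]
  refine mk_toSL_eq (by rw [mul_smul, hk, toSL_smul_I]; rfl) ?_
  have h1 : (toSL q * rotSL t) 1 0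
      = toSL q 1 0 * Real.cos (t / 2) - toSL q 1 1 * Real.sin (t / 2) := by
    rw [SL_mul_apply]; simp [rotSL]; ring
  have h2 : (toSL q * rotSL t) 1 1
      = toSL q 1 0 * Real.sin (t / 2) + toSL q 1 1 * Real.cos (t / 2) := by
    rw [SL_mul_apply]; simp [rotSL]
  have e : (shift t q).2 / 2 = q.2 / 2 + t / 2 := by rw [shift_apply]; dsimp only; ring
  rw [h1, h2, e, Real.cos_add, Real.sin_add, toSL_apply_one_zero, toSL_apply_one_one]
  ring

/-- The derivative of the action of the geodesic flow on directions. -/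
def geoScale (s θ : ℝ) : ℝ :=
  1 / (Real.exp s ^ 2 * Real.sin (θ / 2) ^ 2 + Real.cos (θ / 2) ^ 2 / Real.exp s ^ 2)

/-- The displacement in the horizontal direction under the geodesic flow. -/
def geoShear (s θ : ℝ) : ℝ :=
  (1 / Real.exp s ^ 2 - Real.exp s ^ 2) * Real.sin (θ / 2) * Real.cos (θ / 2) * geoScale s θ

/-- The action of the geodesic flow on directions, as seen from infinity. -/
def geoAngle (s θ : ℝ) : ℝ :=
  θ + 2 * Real.arctan ((Real.exp s ^ 2 - 1) * Real.sin (θ / 2) * Real.cos (θ / 2) /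
    (Real.cos (θ / 2) ^ 2 + Real.exp s ^ 2 * Real.sin (θ / 2) ^ 2))

theorem sin_sq_add_mul_cos_sq_pos {a b : ℝ} (ha : 0 < a) (hb : 0 < b) (φ : ℝ) :
    0 < a * Real.sin φ ^ 2 + b * Real.cos φ ^ 2 := by
  by_cases h : Real.sin φ = 0
  · have : Real.cos φ ^ 2 = 1 := by nlinarith [Real.sin_sq_add_cos_sq φ]
    rw [this, h]; simpa using hb
  · positivity

theorem geoScale_pos (s θ : ℝ) : 0 < geoScale s θ := by
  have hl := Real.exp_pos s
  have := sin_sq_add_mul_cos_sq_pos (a := Real.exp s ^ 2) (b := 1 / Real.exp s ^ 2)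
    (by positivity) (by positivity) (θ / 2)
  unfold geoScale
  rw [one_div_mul_eq_div] at this
  exact one_div_pos.2 this

theorem geoAngle_denom_pos (s θ : ℝ) :
    0 < Real.cos (θ / 2) ^ 2 + Real.exp s ^ 2 * Real.sin (θ / 2) ^ 2 := by
  have hl := Real.exp_pos s
  have := sin_sq_add_mul_cos_sq_pos (a := Real.exp s ^ 2) (b := 1)
    (by positivity) (by positivity) (θ / 2)
  linarith

/-- The affine map `(x, y) ↦ (x + a y, b y)` of the upper half plane. -/
def affineMap (a b : ℝ) (hb : 0 < b) (z : UpperHalfPlane) : UpperHalfPlane :=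
  ⟨⟨z.re + a * z.im, b * z.im⟩, mul_pos hb z.im_pos⟩

/-- The lift of the right translation by `diagSL s`, i.e. of the geodesic flow. -/
def geoFlow (s : ℝ) (q : Cover) : Cover :=
  (affineMap (geoShear s q.2) (geoScale s q.2) (geoScale_pos s q.2) q.1, geoAngle s q.2)

theorem continuous_geoFlow : Continuous fun x : ℝ × Cover => geoFlow x.1 x.2 := by
  have hb : Continuous fun x : ℝ × Cover => geoScale x.1 x.2.2 := by
    refine Continuous.div continuous_const ?_ fun x => (one_div_pos.1 (geoScale_pos _ _)).ne'
    exact Continuous.add (by fun_prop) (Continuous.div (by fun_prop) (by fun_prop)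
      fun x => by positivity)
  have ha : Continuous fun x : ℝ × Cover => geoShear x.1 x.2.2 := by
    refine Continuous.mul ?_ hb
    refine Continuous.mul (Continuous.mul (Continuous.sub (Continuous.div (by fun_prop)
      (by fun_prop) fun x => by positivity) (by fun_prop)) (by fun_prop)) (by fun_prop)
  refine Continuous.prodMk ?_ ?_
  · rw [UpperHalfPlane.isEmbedding_coe.continuous_iff]
    have : Continuous fun x : ℝ × Cover =>
        ((x.2.1.re + geoShear x.1 x.2.2 * x.2.1.im : ℝ) : ℂ)
          + ((geoScale x.1 x.2.2 * x.2.1.im : ℝ) : ℂ) * Complex.I := by fun_prop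
    refine this.congr fun x => ?_
    exact Complex.ext (by simp [affineMap]) (by simp [affineMap])
  · refine Continuous.add (by fun_prop) (continuous_const.mul (Real.continuous_arctan.comp
      (Continuous.div (by fun_prop) (by fun_prop) fun x => (geoAngle_denom_pos _ _).ne')))

theorem geoFlow_zero (q : Cover) : geoFlow 0 q = q := by
  have h1 : geoScale 0 q.2 = 1 := by simp [geoScale]
  have h2 : geoShear 0 q.2 = 0 := by simp [geoShear]
  refine Prod.ext (UpperHalfPlane.ext (Complex.ext ?_ ?_)) ?_
  · simp [geoFlow, affineMap, h2]
  · simp [geoFlow, affineMap, h1]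
  · simp [geoFlow, geoAngle]

/-- The base point moves along a geodesic by the signed length 2s, perpendicular to the unit vector.
The explicit formulas are checked through the two conditions of `mk_toSL_eq`. -/
theorem mk_toSL_geoFlow (s : ℝ) (q : Cover) :
    (toSL (geoFlow s q) : PSL2R) = ((toSL q * diagSL s : SL(2, ℝ)) : PSL2R) := by
  have hl := Real.exp_pos s
  obtain ⟨l, hle⟩ : ∃ l, l = Real.exp s := ⟨_, rfl⟩
  have hy : 0 < √q.1.im := Real.sqrt_pos.2 q.1.im_pos
  have hy2 : √q.1.im ^ 2 = q.1.im := Real.sq_sqrt q.1.im_pos.le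
  have e : ∀ i, (toSL q * diagSL s) i 0 = toSL q i 0 * l ∧
      (toSL q * diagSL s) i 1 = toSL q i 1 / l := fun i => by
    rw [SL_mul_apply, SL_mul_apply]; simp [diagSL, Real.exp_neg, hle, div_eq_mul_inv]
  obtain ⟨σ, hσ⟩ : ∃ σ, σ = Real.sin (q.2 / 2) := ⟨_, rfl⟩
  obtain ⟨κ, hκ⟩ : ∃ κ, κ = Real.cos (q.2 / 2) := ⟨_, rfl⟩
  have hsc : σ ^ 2 + κ ^ 2 = 1 := by rw [hσ, hκ]; exact Real.sin_sq_add_cos_sq _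
  refine mk_toSL_eq (smul_eq_of ?_) ?_
  · have hb := geoScale_pos s q.2
    have hd : 0 < l ^ 2 * σ ^ 2 + κ ^ 2 / l ^ 2 := by
      rw [hle, hσ, hκ]; exact one_div_pos.1 hb
    have hx : (geoFlow s q).1.re = q.1.re
        + (1 / l ^ 2 - l ^ 2) * σ * κ * (1 / (l ^ 2 * σ ^ 2 + κ ^ 2 / l ^ 2)) * q.1.im := by
      rw [hle, hσ, hκ]; rfl
    have hyy : (geoFlow s q).1.im = 1 / (l ^ 2 * σ ^ 2 + κ ^ 2 / l ^ 2) * q.1.im := by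
      rw [hle, hσ, hκ]; rfl
    have hl' : 0 < l := hle ▸ hl
    have hd' : l ^ 2 * σ ^ 2 + κ ^ 2 / l ^ 2 = (l ^ 4 * σ ^ 2 + κ ^ 2) / l ^ 2 := by
      field_simp
    have hd2 : 0 < l ^ 4 * σ ^ 2 + κ ^ 2 := by
      rw [hd'] at hd; exact (div_pos_iff_of_pos_right (by positivity)).1 hd
    rw [den, (e 0).1, (e 0).2, (e 1).1, (e 1).2, toSL_apply_one_zero, toSL_apply_one_one,
      toSL_apply_zero_zero, toSL_apply_zero_one, ← hσ, ← hκ]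
    apply Complex.ext
    · simp only [Complex.mul_re, Complex.mul_im, Complex.add_re, Complex.add_im,
        Complex.ofReal_re, Complex.ofReal_im, UpperHalfPlane.coe_re, UpperHalfPlane.coe_im, hx, hyy,
        UpperHalfPlane.I_re, UpperHalfPlane.I_im]
      rw [hd']
      field_simp
      rw [hy2]
      linear_combination (-(l ^ 4 * σ * q.1.im)) * hsc
    · simp only [Complex.mul_re, Complex.mul_im, Complex.add_re, Complex.add_im,
        Complex.ofReal_re, Complex.ofReal_im, UpperHalfPlane.coe_re, UpperHalfPlane.coe_im, hx, hyy,
        UpperHalfPlane.I_re, UpperHalfPlane.I_im]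
      rw [hd']
      field_simp
      rw [hy2]
      linear_combination (-(l * κ * q.1.im)) * hsc
  · have hd : 0 < κ ^ 2 + l ^ 2 * σ ^ 2 := by rw [hle, hσ, hκ]; exact geoAngle_denom_pos s q.2
    have hl' : 0 < l := hle ▸ hl
    have h2 : (geoFlow s q).2 / 2 = q.2 / 2 + Real.arctan ((l ^ 2 - 1) * σ * κ /
        (κ ^ 2 + l ^ 2 * σ ^ 2)) := by
      rw [hle, hσ, hκ]; change geoAngle s q.2 / 2 = _; rw [geoAngle]; ring
    rw [(e 1).1, (e 1).2, toSL_apply_one_zero, toSL_apply_one_one, h2, Real.cos_add, Real.sin_add,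
      ← hσ, ← hκ]
    obtain ⟨u, hu⟩ : ∃ u, u = (l ^ 2 - 1) * σ * κ / (κ ^ 2 + l ^ 2 * σ ^ 2) := ⟨_, rfl⟩
    rw [← hu]
    have hsin : Real.sin (Real.arctan u) = u * Real.cos (Real.arctan u) := by
      rw [Real.sin_arctan, Real.cos_arctan]; ring
    have hu' : u * (κ ^ 2 + l ^ 2 * σ ^ 2) = (l ^ 2 - 1) * σ * κ := by
      rw [hu]; field_simp
    rw [hsin]
    generalize Real.cos (Real.arctan u) = w
    have : -σ / √q.1.im * l * (κ * w - σ * (u * w)) + κ / √q.1.im / l * (σ * w + κ * (u * w))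
        = w / (√q.1.im * l) * (u * (κ ^ 2 + l ^ 2 * σ ^ 2) - (l ^ 2 - 1) * σ * κ) := by
      field_simp
      ring
    rw [this, hu', sub_self, mul_zero]

/-! ### Relations between the geodesic flow and rotations of the fibre -/

theorem mk_toSL_geoFlow_shift (s t : ℝ) (q : Cover) :
    (toSL (geoFlow s (shift t q)) : PSL2R)
      = (toSL q : PSL2R) * ((rotSL t * diagSL s : SL(2, ℝ)) : PSL2R) := by
  rw [mk_toSL_geoFlow, QuotientGroup.mk_mul, mk_toSL_shift_eq, QuotientGroup.mk_mul, mul_assoc]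
  rfl

theorem trace_rotSL_mul_diagSL (s t : ℝ) : (rotSL t * diagSL s) 0 0 + (rotSL t * diagSL s) 1 1
    = Real.cos (t / 2) * (Real.exp s + Real.exp (-s)) := by
  rw [SL_mul_apply, SL_mul_apply]; simp [rotSL, diagSL]; ring

theorem SL_sq_apply (g : SL(2, ℝ)) : ((g ^ 2 : SL(2, ℝ)) : Matrix (Fin 2) (Fin 2) ℝ)
    = (g 0 0 + g 1 1) • (g : Matrix (Fin 2) (Fin 2) ℝ) - 1 := by
  have h := det_eq g
  rw [Matrix.SpecialLinearGroup.coe_pow, sq]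
  ext i j
  fin_cases i <;> fin_cases j <;> simp [Matrix.mul_apply, Fin.sum_univ_two] <;> linarith

theorem SL_sq_eq_neg_one {g : SL(2, ℝ)} (h : g 0 0 + g 1 1 = 0) : g ^ 2 = -1 := by
  apply Subtype.ext
  rw [SL_sq_apply, h]
  simp

/-- By Cayley-Hamilton the trace of g² is (tr g)² - 2 = 0, so g² is a square root of -1. -/
theorem SL_pow_four_eq_neg_one {g : SL(2, ℝ)} (h : (g 0 0 + g 1 1) ^ 2 = 2) : g ^ 4 = -1 := by
  have h4 : g ^ 4 = (g ^ 2) ^ 2 := by rw [← pow_mul]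
  rw [h4]
  refine SL_sq_eq_neg_one ?_
  rw [SL_sq_apply]
  simp
  linear_combination h

theorem mk_neg_one : ((-1 : SL(2, ℝ)) : PSL2R) = 1 :=
  (mk_eq_of_eq_or_eq_neg (Or.inr rfl)).symm

theorem shift_shift (a b : ℝ) (q : Cover) : shift a (shift b q) = shift (a + b) q := by
  simp only [shift_apply]; congr 1; ring

theorem continuous_shift : Continuous fun x : ℝ × Cover => shift x.1 x.2 := by
  simp only [shift_apply]; fun_prop

theorem continuous_geoFlow_shift {α : ℝ → ℝ} (hα : Continuous α) {u : ℝ → Cover}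
    (hu : Continuous u) : Continuous fun s => geoFlow s (shift (α s) (u s)) :=
  continuous_geoFlow.comp (continuous_id.prodMk (continuous_shift.comp (hα.prodMk hu)))

theorem mk_toSL_shift_two_pi (q : Cover) :
    (toSL (shift (2 * Real.pi) q) : PSL2R) = (toSL q : PSL2R) := by
  simpa using mk_toSL_shift_int q 1

/-- Walking along a segment and back, with two half turns. In PSL the relation holds for every s by
the trace; the lifts agree at s = 0, hence for all s by uniqueness of lifts. -/
theorem geoFlow_shift_pi_iterate (s : ℝ) (q : Cover) :
    (fun p => geoFlow s (shift Real.pi p))^[2] q = shift (2 * Real.pi) q := by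
  have key := eq_of_mk_toSL_comp_eq (X := ℝ) (x₀ := 0)
    (u := fun s => geoFlow s (shift Real.pi (geoFlow s (shift Real.pi q))))
    (v := fun _ => shift (2 * Real.pi) q)
    (continuous_geoFlow_shift continuous_const (continuous_geoFlow_shift continuous_const
      continuous_const)) continuous_const (fun s => ?_) ?_
  · exact congrFun key s
  · have h : (rotSL Real.pi * diagSL s) ^ 2 = -1 := SL_sq_eq_neg_one (by
      rw [trace_rotSL_mul_diagSL]; simp)
    rw [mk_toSL_geoFlow_shift, mk_toSL_geoFlow_shift, mul_assoc, ← QuotientGroup.mk_mul, ← sq, h,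
      mk_neg_one, mul_one, mk_toSL_shift_two_pi]
  · simp only [geoFlow_zero, shift_shift]
    congr 1; ring_nf

/-- The exterior angle of the regular quadrilateral whose side is determined by `s`. -/
def squareAngle (s : ℝ) : ℝ := 2 * Real.arccos (√2 / (Real.exp s + Real.exp (-s)))

/-- Walking around a regular quadrilateral. The angle is chosen so that the trace is √2. At s = 0
the walk reduces to four quarter turns, which fixes the lift to be exactly one full turn. -/
theorem geoFlow_shift_squareAngle_iterate (s : ℝ) (q : Cover) :
    (fun p => geoFlow s (shift (squareAngle s) p))^[4] q = shift (2 * Real.pi) q := by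
  have hpos : ∀ s : ℝ, 0 < Real.exp s + Real.exp (-s) := fun s =>
    add_pos (Real.exp_pos _) (Real.exp_pos _)
  have hα : Continuous squareAngle := by
    refine continuous_const.mul (Real.continuous_arccos.comp (Continuous.div (by fun_prop)
      (by fun_prop) fun s => (hpos s).ne'))
  have key := eq_of_mk_toSL_comp_eq (X := ℝ) (x₀ := 0)
    (u := fun s => geoFlow s (shift (squareAngle s) (geoFlow s (shift (squareAngle s)
      (geoFlow s (shift (squareAngle s) (geoFlow s (shift (squareAngle s) q))))))))
    (v := fun _ => shift (2 * Real.pi) q)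
    (continuous_geoFlow_shift hα (continuous_geoFlow_shift hα (continuous_geoFlow_shift hα
      (continuous_geoFlow_shift hα continuous_const)))) continuous_const (fun s => ?_) ?_
  · exact congrFun key s
  · have h : (rotSL (squareAngle s) * diagSL s) ^ 4 = -1 := SL_pow_four_eq_neg_one (by
      have h2 : 2 ≤ Real.exp s + Real.exp (-s) := by
        have := Real.one_le_cosh s; rw [Real.cosh_eq] at this; linarith
      have h3 : √2 / (Real.exp s + Real.exp (-s)) ≤ 1 := by
        rw [div_le_one (hpos s)]
        refine le_trans ?_ h2
        rw [Real.sqrt_le_left (by norm_num)]; norm_num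
      have h4 : (0 : ℝ) ≤ √2 / (Real.exp s + Real.exp (-s)) :=
        div_nonneg (Real.sqrt_nonneg _) (hpos s).le
      rw [trace_rotSL_mul_diagSL, squareAngle, mul_div_cancel_left₀ _ two_ne_zero,
        Real.cos_arccos (by linarith) h3, div_mul_cancel₀ _ (hpos s).ne',
        Real.sq_sqrt (by norm_num)])
    rw [mk_toSL_geoFlow_shift, mk_toSL_geoFlow_shift, mk_toSL_geoFlow_shift, mk_toSL_geoFlow_shift,
      mk_toSL_shift_two_pi]
    have h5 : (((rotSL (squareAngle s) * diagSL s : SL(2, ℝ)) : PSL2R)) ^ 4 = 1 := by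
      rw [← QuotientGroup.mk_pow, h, mk_neg_one]
    simp only [mul_assoc]
    rw [← pow_two, ← pow_succ', ← pow_succ', h5, mul_one]
  · have h0 : squareAngle 0 = Real.pi / 2 := by
      have : √2 / (Real.exp 0 + Real.exp (-0)) = Real.cos (Real.pi / 4) := by
        rw [Real.cos_pi_div_four]; norm_num
      rw [squareAngle, this, Real.arccos_cos (by positivity) (by linarith [Real.pi_pos])]
      ring
    simp only [geoFlow_zero, shift_shift, h0]
    congr 1; ring_nf

/-- Here e^s + e^{-s} = 2√2, so the half angle has cosine 1/2. An angle that is a third of a full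
turn lets the quadrilateral relation be compared with iterates of a rotation, with no continuity
argument. -/
theorem squareAngle_log : squareAngle (Real.log (√2 + 1)) = 2 * Real.pi / 3 := by
  have h2 : √2 ^ 2 = (2 : ℝ) := Real.sq_sqrt (by norm_num)
  have hs : (0 : ℝ) ≤ √2 := Real.sqrt_nonneg _
  have h3 : (√2 + 1)⁻¹ = √2 - 1 := by
    rw [inv_eq_iff_eq_inv, eq_comm]
    refine inv_eq_of_mul_eq_one_left ?_
    linear_combination h2
  have : √2 / (Real.exp (Real.log (√2 + 1)) + Real.exp (-Real.log (√2 + 1)))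
      = Real.cos (Real.pi / 3) := by
    rw [Real.exp_neg, Real.exp_log (by positivity), h3, Real.cos_pi_div_three]
    have : (0 : ℝ) < √2 := by positivity
    field_simp
    ring
  rw [squareAngle, this, Real.arccos_cos (by positivity) (by linarith [Real.pi_pos])]
  ring

theorem geoFlow_deck {Γ : Subgroup PSL2R} [DiscreteTopology Γ] {φ : Cover ≃ₜ Cover}
    (hφ : φ ∈ deckGroup Γ) (s : ℝ) (q : Cover) : geoFlow s (φ q) = φ (geoFlow s q) := by
  obtain ⟨γ, -, h⟩ := exists_mk_toSL_deck hφ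
  have hf : ∀ q, Continuous fun s => geoFlow s q := fun q =>
    continuous_geoFlow.comp (continuous_id.prodMk continuous_const)
  refine congrFun (eq_of_mk_toSL_comp_eq (X := ℝ) (x₀ := 0) (hf (φ q))
    (φ.continuous.comp (hf q)) (fun s => ?_) ?_) s
  · simp only [Function.comp_apply]
    rw [h, mk_toSL_geoFlow, mk_toSL_geoFlow, QuotientGroup.mk_mul, QuotientGroup.mk_mul, ← mul_assoc]
    congr 1
    exact h q
  · simp [geoFlow_zero]

theorem shift_deck {Γ : Subgroup PSL2R} [DiscreteTopology Γ] {φ : Cover ≃ₜ Cover}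
    (hφ : φ ∈ deckGroup Γ) (t : ℝ) (q : Cover) : shift t (φ q) = φ (shift t q) := by
  obtain ⟨g, -, n, rfl⟩ := exists_eq_shift_lift hφ
  change shift t (shift _ (lift g q)) = shift _ (lift g (shift t q))
  simp only [shift_apply, lift_apply]
  congr 1
  ring

/-! ### Invariance of the volume -/

theorem measurePreserving_lift (g : SL(2, ℝ)) : MeasurePreserving (lift g) volume volume := by
  have h1 : MeasurePreserving (fun z : UpperHalfPlane => g • z) volume volume :=
    measurePreserving_smul (g : GL (Fin 2) ℝ) (volume : Measure UpperHalfPlane)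
  have := (continuous_arg_den g).measurable
  refine h1.skew_product (g := fun z θ => θ - 2 * Complex.arg (den g z)) ?_ ?_
  · simp only [Function.uncurry_def]
    exact measurable_snd.sub ((this.comp measurable_fst).const_mul 2)
  · exact ae_of_all _ fun z => map_sub_right_eq_self volume _

theorem measurePreserving_shift (t : ℝ) : MeasurePreserving (shift t) volume volume :=
  (MeasurePreserving.id (volume : Measure UpperHalfPlane)).prod
    (measurePreserving_add_right (volume : Measure ℝ) t)

theorem measurePreserving_deck {Γ : Subgroup PSL2R} [DiscreteTopology Γ] {φ : Cover ≃ₜ Cover}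
    (hφ : φ ∈ deckGroup Γ) : MeasurePreserving φ volume volume := by
  obtain ⟨g, -, n, rfl⟩ := exists_eq_shift_lift hφ
  exact (measurePreserving_shift _).comp (measurePreserving_lift g)

theorem continuous_affineMap (a b : ℝ) (hb : 0 < b) : Continuous (affineMap a b hb) := by
  rw [UpperHalfPlane.isEmbedding_coe.continuous_iff]
  have : Continuous fun z : UpperHalfPlane =>
      ((z.re + a * z.im : ℝ) : ℂ) + ((b * z.im : ℝ) : ℂ) * Complex.I := by fun_prop
  exact this.congr fun z => Complex.ext (by simp [affineMap]) (by simp [affineMap])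

theorem bijective_affineMap (a b : ℝ) (hb : 0 < b) : Function.Bijective (affineMap a b hb) := by
  constructor
  · intro z w h
    have hre : z.re + a * z.im = w.re + a * w.im := congrArg UpperHalfPlane.re h
    have him : b * z.im = b * w.im := congrArg UpperHalfPlane.im h
    have him' : z.im = w.im := mul_left_cancel₀ hb.ne' him
    exact UpperHalfPlane.ext (Complex.ext (by rw [him'] at hre; exact add_right_cancel hre) him')
  · intro w
    refine ⟨⟨⟨w.re - a * (w.im / b), w.im / b⟩, div_pos w.im_pos hb⟩, ?_⟩
    refine UpperHalfPlane.ext (Complex.ext ?_ ?_)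
    · change w.re - a * (w.im / b) + a * (w.im / b) = w.re
      ring
    · change b * (w.im / b) = w.im
      field_simp

/-- The linear extension of `affineMap` to the complex plane. -/
def affineLinear (a b : ℝ) : ℂ →L[ℝ] ℂ :=
  (LinearMap.toContinuousLinearMap (Matrix.toLin Complex.basisOneI Complex.basisOneI
    !![1, a; 0, b]))

theorem affineLinear_det (a b : ℝ) : (affineLinear a b).det = b := by
  rw [affineLinear, ContinuousLinearMap.det]
  simp

theorem affineLinear_apply (a b : ℝ) (z : ℂ) :
    affineLinear a b z = ⟨z.re + a * z.im, b * z.im⟩ := by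
  rw [affineLinear]
  simp only [LinearMap.coe_toContinuousLinearMap', Matrix.toLin_apply, Fin.sum_univ_two,
    Complex.coe_basisOneI, Complex.coe_basisOneI_repr, Matrix.mulVec, dotProduct]
  apply Complex.ext <;> simp

/-- The linear map has determinant b and the density 1/y² contributes a factor b² against it; the
push-forward is scaled by b. -/
theorem map_affineMap_volume (a b : ℝ) (hb : 0 < b) :
    Measure.map (affineMap a b hb) volume = ENNReal.ofReal b • volume := by
  ext S hS
  rw [Measure.map_apply (continuous_affineMap a b hb).measurable hS, Measure.smul_apply,
    UpperHalfPlane.volume_eq_lintegral, UpperHalfPlane.volume_eq_lintegral]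
  have himage : (UpperHalfPlane.coe '' S) =
      affineLinear a b '' (UpperHalfPlane.coe '' (affineMap a b hb ⁻¹' S)) := by
    conv_lhs => rw [← (bijective_affineMap a b hb).surjective.image_preimage S]
    rw [image_image, image_image]
    refine image_congr fun z _ => ?_
    rw [affineLinear_apply]
    rfl
  have hm : MeasurableSet (UpperHalfPlane.coe '' (affineMap a b hb ⁻¹' S)) :=
    UpperHalfPlane.measurableEmbedding_coe.measurableSet_image.2
      ((continuous_affineMap a b hb).measurable hS)
  rw [himage, lintegral_image_eq_lintegral_abs_det_fderiv_mul volume hm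
    (fun x _ => (affineLinear a b).hasFDerivWithinAt), affineLinear_det, abs_of_pos hb,
    lintegral_const_mul' _ _ ENNReal.ofReal_ne_top, smul_eq_mul, ← mul_assoc,
    ← lintegral_const_mul' _ _ (by finiteness)]
  · refine setLIntegral_congr_fun hm fun z hz => ?_
    obtain ⟨w, -, rfl⟩ := hz
    simp only [affineLinear_apply]
    simp only [ENNReal.ofReal]
    norm_cast
    ext
    push_cast
    simp only [Real.coe_toNNReal b hb.le, norm_mul, Real.norm_eq_abs, abs_of_pos hb]
    have : |(w : ℂ).im| ≠ 0 := abs_ne_zero.2 w.im_pos.ne'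
    field_simp
  · rintro _ ⟨z, -, rfl⟩ _ ⟨w, -, rfl⟩ h
    rw [affineLinear_apply, affineLinear_apply] at h
    exact congrArg UpperHalfPlane.coe ((bijective_affineMap a b hb).injective (UpperHalfPlane.ext h))

theorem hasDerivAt_geoAngle (s θ : ℝ) : HasDerivAt (geoAngle s) (geoScale s θ) θ := by
  have hd := geoAngle_denom_pos s θ
  have hb := one_div_pos.1 (geoScale_pos s θ)
  have hh : HasDerivAt (fun θ : ℝ => θ / 2) (1 / 2) θ := (hasDerivAt_id θ).div_const 2
  have h := (hasDerivAt_id θ).add ((((hh.sin.const_mul (Real.exp s ^ 2 - 1)).mul hh.cos).div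
    ((hh.cos.pow 2).add ((hh.sin.pow 2).const_mul (Real.exp s ^ 2))) hd.ne').arctan.const_mul 2)
  refine h.congr_deriv ?_
  have hl := Real.exp_pos s
  simp only [Pi.div_apply, Pi.mul_apply, Pi.add_apply, Pi.pow_apply, geoScale]
  have hsc := Real.sin_sq_add_cos_sq (θ / 2)
  generalize Real.exp s = l at *
  generalize Real.sin (θ / 2) = σ at *
  generalize Real.cos (θ / 2) = κ at *
  have hd2 : 0 < l ^ 4 * σ ^ 2 + κ ^ 2 := by
    have : l ^ 4 * σ ^ 2 + κ ^ 2 = l ^ 2 * (l ^ 2 * σ ^ 2 + κ ^ 2 / l ^ 2) := by field_simp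
    rw [this]; positivity
  have e : 1 + ((l ^ 2 - 1) * σ * κ / (κ ^ 2 + l ^ 2 * σ ^ 2)) ^ 2
      = (l ^ 4 * σ ^ 2 + κ ^ 2) / (κ ^ 2 + l ^ 2 * σ ^ 2) ^ 2 := by
    field_simp
    linear_combination (l ^ 4 * σ ^ 2 + κ ^ 2) * hsc
  have e2 : l ^ 2 * σ ^ 2 + κ ^ 2 / l ^ 2 = (l ^ 4 * σ ^ 2 + κ ^ 2) / l ^ 2 := by field_simp
  rw [e, e2]
  simp only [Nat.cast_ofNat, Nat.add_one_sub_one, pow_one]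
  field_simp
  linear_combination ((l ^ 2 - 1) * (κ ^ 2 - l ^ 2 * σ ^ 2) + l ^ 2) * hsc

theorem bijective_geoAngle (s : ℝ) : Function.Bijective (geoAngle s) := by
  have hmono : StrictMono (geoAngle s) := strictMono_of_hasDerivAt_pos (hasDerivAt_geoAngle s)
    (geoScale_pos s)
  have hcont : Continuous (geoAngle s) :=
    continuous_iff_continuousAt.2 fun θ => (hasDerivAt_geoAngle s θ).continuousAt
  refine ⟨hmono.injective, hcont.surjective ?_ ?_⟩
  · refine tendsto_atTop_mono (f := fun θ => θ + -Real.pi) (fun θ => ?_)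
      (tendsto_atTop_add_const_right _ _ tendsto_id)
    have := Real.neg_pi_div_two_lt_arctan ((Real.exp s ^ 2 - 1) * Real.sin (θ / 2) *
      Real.cos (θ / 2) / (Real.cos (θ / 2) ^ 2 + Real.exp s ^ 2 * Real.sin (θ / 2) ^ 2))
    unfold geoAngle
    linarith
  · refine tendsto_atBot_mono (fun θ => (?_ : geoAngle s θ ≤ θ + Real.pi))
      (tendsto_atBot_add_const_right _ _ tendsto_id)
    have := Real.arctan_lt_pi_div_two ((Real.exp s ^ 2 - 1) * Real.sin (θ / 2) *
      Real.cos (θ / 2) / (Real.cos (θ / 2) ^ 2 + Real.exp s ^ 2 * Real.sin (θ / 2) ^ 2))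
    unfold geoAngle
    linarith

theorem continuous_geoFlow_apply (s : ℝ) : Continuous (geoFlow s) :=
  continuous_geoFlow.comp (continuous_const.prodMk continuous_id)

/-- By Fubini: at fixed θ the base volume is scaled by `geoScale`, and this is exactly the
derivative of the map `geoAngle` on directions, so the change of variables in θ absorbs it. -/
theorem measurePreserving_geoFlow (s : ℝ) : MeasurePreserving (geoFlow s) volume volume := by
  have hm : Measurable (geoFlow s) := (continuous_geoFlow_apply s).measurable
  refine ⟨hm, Measure.ext_of_lintegral _ fun f hf => ?_⟩
  rw [lintegral_map hf hm, Measure.volume_eq_prod,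
    lintegral_prod_symm' (fun q => f (geoFlow s q)) (hf.comp hm), lintegral_prod_symm' _ hf]
  have h1 : ∀ θ, ∫⁻ z, f (geoFlow s (z, θ)) ∂(volume : Measure UpperHalfPlane)
      = ENNReal.ofReal |geoScale s θ| * ∫⁻ z, f (z, geoAngle s θ) := fun θ => by
    have hc := (continuous_affineMap (geoShear s θ) (geoScale s θ) (geoScale_pos s θ)).measurable
    have hf' : Measurable fun z : UpperHalfPlane => f (z, geoAngle s θ) := by fun_prop
    rw [abs_of_pos (geoScale_pos s θ), ← smul_eq_mul, ← lintegral_smul_measure,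
      ← map_affineMap_volume (geoShear s θ) _ (geoScale_pos s θ), lintegral_map hf' hc]
    rfl
  simp_rw [h1]
  have := lintegral_image_eq_lintegral_abs_deriv_mul (s := univ) MeasurableSet.univ
    (fun θ _ => (hasDerivAt_geoAngle s θ).hasDerivWithinAt) (bijective_geoAngle s).injective.injOn
    (fun θ => ∫⁻ z : UpperHalfPlane, f (z, θ))
  rw [image_univ, (bijective_geoAngle s).surjective.range_eq, Measure.restrict_univ] at this
  exact this.symm

/-! ### Averaging over the quotient by a properly discontinuous cocompact group -/

section Averaging

variable {X : Type*} [TopologicalSpace X]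

/-- The number of translates of the point `p` under the group `D` which lie in `K`. -/
def multiplicity (D : Subgroup (X ≃ₜ X)) (K : Set X) (p : X) : ℝ≥0∞ :=
  ∑' φ : D, K.indicator 1 ((φ : X ≃ₜ X) p)

/-- A function supported in `K` whose translates under the group `D` sum up to one. -/
def weight (D : Subgroup (X ≃ₜ X)) (K : Set X) (p : X) : ℝ≥0∞ :=
  K.indicator 1 p * (multiplicity D K p)⁻¹

/-- A function on which the group `D` acts by adding the values of `f`. -/
def primitive (D : Subgroup (X ≃ₜ X)) (K : Set X) (f : D → ℝ) (p : X) : ℝ :=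
  -∑' φ : D, f φ * (weight D K ((φ : X ≃ₜ X) p)).toReal

/-- The group `D` acts properly discontinuously, and the translates of the compact set `K`
cover the space. -/
structure IsCocompactOn (D : Subgroup (X ≃ₜ X)) (K : Set X) : Prop where
  isCompact : IsCompact K
  exists_mem : ∀ p, ∃ φ : D, (φ : X ≃ₜ X) p ∈ K
  finite : ∀ C : Set X, IsCompact C → {φ : D | ∃ p ∈ C, (φ : X ≃ₜ X) p ∈ C}.Finite

variable {D : Subgroup (X ≃ₜ X)} {K : Set X}

theorem multiplicity_apply (ψ : D) (p : X) :
    multiplicity D K ((ψ : X ≃ₜ X) p) = multiplicity D K p :=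
  (Equiv.mulRight ψ).tsum_eq fun φ : D => K.indicator (1 : X → ℝ≥0∞) ((φ : X ≃ₜ X) p)

theorem weight_of_notMem {p : X} (hp : p ∉ K) : weight D K p = 0 := by
  simp [weight, hp]

namespace IsCocompactOn

theorem finite_of_isCompact (h : IsCocompactOn D K) {C : Set X} (hC : IsCompact C) :
    {φ : D | ∃ p ∈ C, (φ : X ≃ₜ X) p ∈ K}.Finite :=
  (h.finite (C ∪ K) (hC.union h.isCompact)).subset fun _ ⟨p, hp, hφ⟩ => ⟨p, Or.inl hp, Or.inr hφ⟩

theorem finite_mem (h : IsCocompactOn D K) (p : X) : {φ : D | (φ : X ≃ₜ X) p ∈ K}.Finite :=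
  (h.finite_of_isCompact (isCompact_singleton (x := p))).subset fun _ hφ => ⟨p, rfl, hφ⟩

theorem one_le_multiplicity (h : IsCocompactOn D K) (p : X) : 1 ≤ multiplicity D K p := by
  obtain ⟨φ, hφ⟩ := h.exists_mem p
  calc (1 : ℝ≥0∞) = K.indicator 1 ((φ : X ≃ₜ X) p) := by simp [hφ]
    _ ≤ _ := ENNReal.le_tsum φ

theorem multiplicity_ne_top (h : IsCocompactOn D K) (p : X) : multiplicity D K p ≠ ∞ := by
  rw [multiplicity, tsum_eq_sum (s := (h.finite_mem p).toFinset) fun φ hφ => by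
    have : (φ : X ≃ₜ X) p ∉ K := by simpa using hφ
    simp [this]]
  refine ENNReal.sum_ne_top.2 fun φ hφ => ?_
  have : (φ : X ≃ₜ X) p ∈ K := by simpa using hφ
  simp [this]

theorem weight_le_one (h : IsCocompactOn D K) (p : X) : weight D K p ≤ 1 := by
  have h2 : (multiplicity D K p)⁻¹ ≤ 1 := ENNReal.inv_le_one.2 (h.one_le_multiplicity p)
  by_cases hp : p ∈ K <;> simp [weight, hp, h2]

theorem tsum_weight (h : IsCocompactOn D K) (p : X) :
    ∑' φ : D, weight D K ((φ : X ≃ₜ X) p) = 1 := by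
  simp only [weight, multiplicity_apply]
  rw [ENNReal.tsum_mul_right]
  exact ENNReal.mul_inv_cancel (zero_lt_one.trans_le (h.one_le_multiplicity p)).ne'
    (h.multiplicity_ne_top p)

theorem summable_mul_weight (h : IsCocompactOn D K) (f : D → ℝ) (p : X) :
    Summable fun φ : D => f φ * (weight D K ((φ : X ≃ₜ X) p)).toReal := by
  refine summable_of_ne_finset_zero (s := (h.finite_mem p).toFinset) fun φ hφ => ?_
  have : (φ : X ≃ₜ X) p ∉ K := by simpa using hφ
  simp [weight_of_notMem this]

/-- Reindexing the sum by φ ↦ φψ⁻¹ replaces f φ by f φ - f ψ, and the weights along an orbit sum to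
one. -/
theorem primitive_apply (h : IsCocompactOn D K) {f : D → ℝ} (hf : ∀ φ ψ, f (φ * ψ) = f φ + f ψ)
    (ψ : D) (p : X) :
    primitive D K f ((ψ : X ≃ₜ X) p) = primitive D K f p + f ψ := by
  have h1 : ∑' φ : D, (weight D K ((φ : X ≃ₜ X) p)).toReal = 1 := by
    rw [← ENNReal.tsum_toReal_eq fun φ => ((h.weight_le_one _).trans_lt ENNReal.one_lt_top).ne,
      h.tsum_weight, ENNReal.toReal_one]
  have h2 := (Equiv.mulRight ψ⁻¹).tsum_eq fun φ : D =>
    f φ * (weight D K ((φ : X ≃ₜ X) ((ψ : X ≃ₜ X) p))).toReal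
  have h3 : ∀ φ : D, ((φ * ψ⁻¹ : D) : X ≃ₜ X) ((ψ : X ≃ₜ X) p) = (φ : X ≃ₜ X) p := fun φ => by
    rw [Subgroup.coe_mul, Subgroup.coe_inv]
    change (φ : X ≃ₜ X) ((ψ : X ≃ₜ X).symm ((ψ : X ≃ₜ X) p)) = _
    rw [Homeomorph.symm_apply_apply]
  have h4 : ∀ φ : D, f (φ * ψ⁻¹) = f φ - f ψ := fun φ => by
    have := hf (φ * ψ⁻¹) ψ
    rw [inv_mul_cancel_right] at this
    linarith
  simp only [Equiv.coe_mulRight, h3, h4, sub_mul] at h2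
  rw [(h.summable_mul_weight f p).tsum_sub (h.summable_mul_weight (fun _ => f ψ) p), tsum_mul_left,
    h1] at h2
  rw [primitive, primitive, ← h2]
  ring

/-- Over a compact set only finitely many group elements contribute to the sum, and the weights are
at most one. -/
theorem exists_abs_primitive_le (h : IsCocompactOn D K) (f : D → ℝ) {C : Set X}
    (hC : IsCompact C) : ∃ B, ∀ p ∈ C, |primitive D K f p| ≤ B := by
  refine ⟨∑ φ ∈ (h.finite_of_isCompact hC).toFinset, |f φ|, fun p hp => ?_⟩
  rw [primitive, abs_neg, tsum_eq_sum (s := (h.finite_of_isCompact hC).toFinset) fun φ hφ => by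
    have : (φ : X ≃ₜ X) p ∉ K := fun h' => hφ (by simpa using ⟨p, hp, h'⟩)
    simp [weight_of_notMem this]]
  refine (Finset.abs_sum_le_sum_abs _ _).trans (Finset.sum_le_sum fun φ _ => ?_)
  rw [abs_mul, abs_of_nonneg ENNReal.toReal_nonneg]
  have := ENNReal.toReal_mono ENNReal.one_ne_top (h.weight_le_one ((φ : X ≃ₜ X) p))
  exact mul_le_of_le_one_right (abs_nonneg _) (by simpa using this)

theorem countable [SigmaCompactSpace X] [Nonempty X] (h : IsCocompactOn D K) : Countable D := by
  obtain ⟨x⟩ := ‹Nonempty X›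
  have hc : ∀ n, {φ : D | ∃ p ∈ insert x (compactCovering X n),
      (φ : X ≃ₜ X) p ∈ insert x (compactCovering X n)}.Countable := fun n =>
    (h.finite _ ((isCompact_compactCovering X n).insert x)).countable
  refine countable_univ_iff.1 ((countable_iUnion hc).mono fun φ _ => ?_)
  obtain ⟨n, hn⟩ := mem_iUnion.1 ((iUnion_compactCovering X).symm ▸ mem_univ ((φ : X ≃ₜ X) x))
  exact mem_iUnion.2 ⟨n, x, mem_insert _ _, mem_insert_of_mem _ hn⟩

variable [MeasurableSpace X] [BorelSpace X]

theorem measurable_weight [Countable D] (hK : MeasurableSet K) : Measurable (weight D K) :=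
  (measurable_one.indicator hK).mul (Measurable.tsum fun φ : D =>
    (measurable_one.indicator hK).comp (φ : X ≃ₜ X).measurable).inv

theorem measurable_primitive [Countable D] (h : IsCocompactOn D K) (hK : MeasurableSet K)
    (f : D → ℝ) : Measurable (primitive D K f) := by
  refine Measurable.neg (measurable_of_tendsto_metrizable' atTop
    (f := fun (s : Finset D) p => ∑ φ ∈ s, f φ * (weight D K ((φ : X ≃ₜ X) p)).toReal)
    (fun s => ?_) (tendsto_pi_nhds.2 fun p => (h.summable_mul_weight f p).hasSum))
  exact Finset.measurable_sum _ fun φ _ =>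
    ((measurable_weight hK).comp (φ : X ≃ₜ X).measurable).ennreal_toReal.const_mul _

/-- Volume preserving maps which commute with `D` preserve integrals over the quotient. -/
theorem lintegral_weight_mul_comp [Countable D] (h : IsCocompactOn D K) (hK : MeasurableSet K)
    {μ : Measure X} (hD : ∀ φ : D, MeasurePreserving (φ : X ≃ₜ X) μ μ)
    {ψ : X → X} (hψ : MeasurePreserving ψ μ μ)
    (hc : ∀ (φ : D) (p : X), ψ ((φ : X ≃ₜ X) p) = (φ : X ≃ₜ X) (ψ p))
    {g : X → ℝ≥0∞} (hg : Measurable g) (hgD : ∀ (φ : D) (p : X), g ((φ : X ≃ₜ X) p) = g p) :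
    ∫⁻ p, weight D K p * g (ψ p) ∂μ = ∫⁻ p, weight D K p * g p ∂μ := by
  have hw := measurable_weight (D := D) hK
  have hwc : ∀ φ : D, Measurable fun p => weight D K ((φ : X ≃ₜ X) p) :=
    fun φ => hw.comp (φ : X ≃ₜ X).measurable
  have hgψ : Measurable fun p => g (ψ p) := hg.comp hψ.measurable
  have hwψ : Measurable fun p => weight D K (ψ p) := hw.comp hψ.measurable
  have hinv : ∀ (φ : D) (p : X), ((φ⁻¹ : D) : X ≃ₜ X) ((φ : X ≃ₜ X) p) = p := fun φ p => by
    rw [Subgroup.coe_inv]; exact (φ : X ≃ₜ X).symm_apply_apply p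
  -- Unfolding: a second partition of unity is inserted at ψ p, each summand is moved by a measure
  -- preserving φ, and the first partition is then summed away.
  calc ∫⁻ p, weight D K p * g (ψ p) ∂μ
      = ∫⁻ p, ∑' φ : D, weight D K p * (weight D K ((φ : X ≃ₜ X) (ψ p)) * g (ψ p)) ∂μ := by
        refine lintegral_congr fun p => ?_
        rw [ENNReal.tsum_mul_left, ENNReal.tsum_mul_right, h.tsum_weight, one_mul]
    _ = ∑' φ : D, ∫⁻ p, weight D K p * (weight D K ((φ : X ≃ₜ X) (ψ p)) * g (ψ p)) ∂μ :=
        lintegral_tsum fun φ =>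
          (hw.mul (((hwc φ).comp hψ.measurable).mul hgψ)).aemeasurable
    _ = ∑' φ : D, ∫⁻ p, weight D K (((φ⁻¹ : D) : X ≃ₜ X) p) * (weight D K (ψ p) * g (ψ p)) ∂μ := by
        refine tsum_congr fun φ => ?_
        refine Eq.trans (lintegral_congr fun p => ?_) ((hD φ).lintegral_comp
          (f := fun p => weight D K (((φ⁻¹ : D) : X ≃ₜ X) p) * (weight D K (ψ p) * g (ψ p)))
          ((hwc φ⁻¹).mul (hwψ.mul hgψ)))
        rw [hinv, hc, hgD]
    _ = ∫⁻ p, ∑' φ : D, weight D K (((φ⁻¹ : D) : X ≃ₜ X) p) * (weight D K (ψ p) * g (ψ p)) ∂μ :=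
        (lintegral_tsum fun φ => ((hwc φ⁻¹).mul (hwψ.mul hgψ)).aemeasurable).symm
    _ = ∫⁻ p, weight D K (ψ p) * g (ψ p) ∂μ := by
        refine lintegral_congr fun p => ?_
        have e := (Equiv.inv D).tsum_eq fun φ : D => weight D K ((φ : X ≃ₜ X) p)
        simp only [Equiv.inv_apply] at e
        rw [ENNReal.tsum_mul_right, e, h.tsum_weight, one_mul]
    _ = ∫⁻ p, weight D K p * g p ∂μ := hψ.lintegral_comp (hw.mul hg)

end IsCocompactOn

/-- A volume preserving continuous map which commutes with the group `D`. -/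
structure IsFlowMap (D : Subgroup (X ≃ₜ X)) [MeasurableSpace X] (μ : Measure X) (ψ : X → X) :
    Prop where
  continuous : Continuous ψ
  measurePreserving : MeasurePreserving ψ μ μ
  comm : ∀ (φ : D) (p : X), ψ ((φ : X ≃ₜ X) p) = (φ : X ≃ₜ X) (ψ p)

theorem IsFlowMap.comp [MeasurableSpace X] {μ : Measure X} {ψ χ : X → X}
    (hψ : IsFlowMap D μ ψ) (hχ : IsFlowMap D μ χ) : IsFlowMap D μ (ψ ∘ χ) where
  continuous := hψ.continuous.comp hχ.continuous
  measurePreserving := hψ.measurePreserving.comp hχ.measurePreserving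
  comm φ p := by rw [Function.comp_apply, Function.comp_apply, hχ.comm, hψ.comm]

/-- The average displacement of a map, as measured by a homomorphism `f`. -/
def displacement (D : Subgroup (X ≃ₜ X)) (K : Set X) (f : D → ℝ) [MeasurableSpace X]
    (μ : Measure X) (ψ : X → X) : ℝ :=
  ∫ p, (primitive D K f (ψ p) - primitive D K f p) ∂(μ.withDensity (weight D K))

namespace IsCocompactOn

variable [MeasurableSpace X] {μ : Measure X}

theorem withDensity_univ_le (h : IsCocompactOn D K) (hK : MeasurableSet K) :
    μ.withDensity (weight D K) univ ≤ μ K := by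
  rw [withDensity_apply _ MeasurableSet.univ, setLIntegral_univ, ← lintegral_indicator_one hK]
  refine lintegral_mono fun p => ?_
  by_cases hp : p ∈ K
  · simpa [hp] using h.weight_le_one p
  · simp [weight_of_notMem hp]

theorem displacement_coe (h : IsCocompactOn D K) {f : D → ℝ} (hf : ∀ φ ψ, f (φ * ψ) = f φ + f ψ)
    (φ : D) : displacement D K f μ (φ : X ≃ₜ X)
      = f φ * (μ.withDensity (weight D K)).real univ := by
  simp [displacement, h.primitive_apply hf, mul_comm]

variable [BorelSpace X]

theorem integrable_displacement [Countable D] [IsFiniteMeasureOnCompacts μ]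
    (h : IsCocompactOn D K) (hK : MeasurableSet K) (f : D → ℝ) {ψ : X → X}
    (hψ : Continuous ψ) :
    Integrable (fun p => primitive D K f (ψ p) - primitive D K f p)
      (μ.withDensity (weight D K)) := by
  have : IsFiniteMeasure (μ.withDensity (weight D K)) :=
    ⟨(h.withDensity_univ_le hK).trans_lt h.isCompact.measure_lt_top⟩
  obtain ⟨B₁, h₁⟩ := h.exists_abs_primitive_le f h.isCompact
  obtain ⟨B₂, h₂⟩ := h.exists_abs_primitive_le f (h.isCompact.image hψ)
  have hF := h.measurable_primitive hK f
  refine Integrable.of_bound ((hF.comp hψ.measurable).sub hF).aestronglyMeasurable (B₂ + B₁) ?_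
  rw [ae_withDensity_iff (measurable_weight hK)]
  refine Eventually.of_forall fun p hp => ?_
  have hpK : p ∈ K := by
    by_contra hp'
    exact hp (weight_of_notMem hp')
  rw [Real.norm_eq_abs]
  exact (abs_sub _ _).trans (add_le_add (h₂ _ (mem_image_of_mem ψ hpK)) (h₁ p hpK))

/-- Comparing the distributions of g and g ∘ ψ on ℝ reduces the claim to indicator functions, so no
integrability of g is needed. -/
theorem integral_comp [Countable D] (h : IsCocompactOn D K) (hK : MeasurableSet K)
    (hD : ∀ φ : D, MeasurePreserving (φ : X ≃ₜ X) μ μ) {ψ : X → X} (hψ : IsFlowMap D μ ψ)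
    {g : X → ℝ} (hg : Measurable g) (hgD : ∀ (φ : D) (p : X), g ((φ : X ≃ₜ X) p) = g p) :
    ∫ p, g (ψ p) ∂(μ.withDensity (weight D K)) = ∫ p, g p ∂(μ.withDensity (weight D K)) := by
  have hgψ : Measurable fun p => g (ψ p) := hg.comp hψ.continuous.measurable
  have key : (μ.withDensity (weight D K)).map (fun p => g (ψ p))
      = (μ.withDensity (weight D K)).map g := by
    ext s hs
    have hform : ∀ u : X → ℝ, Measurable u → (μ.withDensity (weight D K)).map u s
        = ∫⁻ p, weight D K p * s.indicator 1 (u p) ∂μ := fun u hu => by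
      rw [Measure.map_apply hu hs, withDensity_apply _ (hu hs), ← lintegral_indicator (hu hs)]
      refine lintegral_congr fun p => ?_
      by_cases hp : u p ∈ s <;> simp [hp]
    rw [hform _ hgψ, hform _ hg]
    exact h.lintegral_weight_mul_comp hK hD hψ.measurePreserving hψ.comm
      (g := fun p => s.indicator 1 (g p)) ((measurable_one.indicator hs).comp hg)
      fun φ p => by rw [hgD]
  have h1 := integral_map (μ := μ.withDensity (weight D K)) hgψ.aemeasurable
    (f := fun x : ℝ => x) aestronglyMeasurable_id
  have h2 := integral_map (μ := μ.withDensity (weight D K)) hg.aemeasurable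
    (f := fun x : ℝ => x) aestronglyMeasurable_id
  rw [← h1, ← h2, key]

theorem displacement_comp [Countable D] [IsFiniteMeasureOnCompacts μ] (h : IsCocompactOn D K)
    (hK : MeasurableSet K) (hD : ∀ φ : D, MeasurePreserving (φ : X ≃ₜ X) μ μ) {f : D → ℝ}
    (hf : ∀ φ ψ, f (φ * ψ) = f φ + f ψ) {ψ χ : X → X} (hψ : IsFlowMap D μ ψ)
    (hχ : IsFlowMap D μ χ) :
    displacement D K f μ (ψ ∘ χ) = displacement D K f μ ψ + displacement D K f μ χ := by
  have hF := h.measurable_primitive hK f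
  -- The increment of `primitive` under ψ is D-invariant, so its average is unchanged by χ; the
  -- increments along p, χ p, ψ (χ p) then telescope.
  have e := h.integral_comp hK hD hχ (g := fun p => primitive D K f (ψ p) - primitive D K f p)
    ((hF.comp hψ.continuous.measurable).sub hF) fun φ p => by
      rw [hψ.comm, h.primitive_apply hf, h.primitive_apply hf]; ring
  have i1 := h.integrable_displacement (μ := μ) hK f (hψ.continuous.comp hχ.continuous)
  have i2 := h.integrable_displacement (μ := μ) hK f hχ.continuous
  unfold displacement
  rw [← e, ← integral_add _ i2]
  · refine integral_congr_ae (Eventually.of_forall fun p => ?_)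
    simp only [Function.comp_apply]
    ring
  · refine (i1.sub i2).congr (Eventually.of_forall fun p => ?_)
    simp only [Function.comp_apply, Pi.sub_apply]
    ring

theorem displacement_iterate [Countable D] [IsFiniteMeasureOnCompacts μ] (h : IsCocompactOn D K)
    (hK : MeasurableSet K) (hD : ∀ φ : D, MeasurePreserving (φ : X ≃ₜ X) μ μ) {f : D → ℝ}
    (hf : ∀ φ ψ, f (φ * ψ) = f φ + f ψ) {ψ : X → X} (hψ : IsFlowMap D μ ψ) (n : ℕ) :
    displacement D K f μ ψ^[n] = n * displacement D K f μ ψ := by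
  have hit : ∀ n : ℕ, IsFlowMap D μ ψ^[n] := fun n => by
    induction n with
    | zero => exact ⟨continuous_id, MeasurePreserving.id μ, fun _ _ => rfl⟩
    | succ n ih => rw [Function.iterate_succ]; exact ih.comp hψ
  induction n with
  | zero => simp [displacement]
  | succ n ih =>
    rw [Function.iterate_succ, h.displacement_comp hK hD hf (hit n) hψ, ih]
    push_cast
    ring

/-- If the weight had zero integral, so would all its translates; they sum to one, so μ would
vanish. -/
theorem withDensity_univ_ne_zero [Countable D] (h : IsCocompactOn D K) (hK : MeasurableSet K)
    (hD : ∀ φ : D, MeasurePreserving (φ : X ≃ₜ X) μ μ) (hμ : μ ≠ 0) :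
    μ.withDensity (weight D K) univ ≠ 0 := by
  have hw := measurable_weight (D := D) hK
  rw [withDensity_apply _ MeasurableSet.univ, setLIntegral_univ]
  intro h0
  have h1 : ∫⁻ p, ∑' φ : D, weight D K ((φ : X ≃ₜ X) p) ∂μ = 0 := by
    refine (lintegral_tsum (f := fun (φ : D) p => weight D K ((φ : X ≃ₜ X) p))
      fun φ => (hw.comp (φ : X ≃ₜ X).measurable).aemeasurable).trans ?_
    refine ENNReal.tsum_eq_zero.2 fun φ => ?_
    rw [(hD φ).lintegral_comp hw, h0]
  simp only [h.tsum_weight, lintegral_one, Measure.measure_univ_eq_zero] at h1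
  exact hμ h1

end IsCocompactOn
end Averaging

/-! ### The critical value of the abelian cover -/

/-- Used to know that the discrete subgroup Γ meets a compact set in finitely many elements. -/
instance : T2Space PSL2R :=
  haveI : IsClosed (Subgroup.center SL(2, ℝ) : Set SL(2, ℝ)) := by
    rw [← Subgroup.centralizer_univ]
    exact Set.isClosed_centralizer _
  inferInstanceAs (T2Space (SL(2, ℝ) ⧸ Subgroup.center SL(2, ℝ)))

theorem volume_cover_ne_zero : (volume : Measure Cover) ≠ 0 := by
  have h1 : (volume : Measure UpperHalfPlane) univ ≠ 0 := fun h => by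
    have h2 : (volume.comap UpperHalfPlane.coe : Measure UpperHalfPlane)
        ≪ (volume : Measure UpperHalfPlane) := by
      rw [UpperHalfPlane.volume_def]
      refine withDensity_absolutelyContinuous' (Continuous.aemeasurable ?_)
        (Eventually.of_forall fun z => ?_)
      · refine ENNReal.continuous_coe.comp (Continuous.pow ?_ 2)
        exact Continuous.subtype_mk (continuous_const.div UpperHalfPlane.continuous_im
          fun z => z.im_pos.ne') _
      · rw [ENNReal.coe_ne_zero]
        exact pow_ne_zero 2 (Subtype.coe_ne_coe.1 (one_div_pos.2 z.im_pos).ne')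
    have h3 := h2 h
    rw [UpperHalfPlane.measurableEmbedding_coe.comap_apply, image_univ] at h3
    exact (UpperHalfPlane.isOpenEmbedding_coe.isOpen_range.measure_pos volume
      ⟨_, mem_range_self UpperHalfPlane.I⟩).ne' h3
  rw [← Measure.measure_univ_ne_zero, ← univ_prod_univ, Measure.volume_eq_prod, Measure.prod_prod]
  exact mul_ne_zero h1 (by simp)

/-! ### Cocompactness of the deck group and vanishing of homomorphisms on the fibre -/

section Deck

variable {Γ : Subgroup PSL2R}

/-- The underlying element of Γ lies in a compact set, which leaves finitely many choices. For each
of them the number n of fibre turns is bounded, because θ is bounded on C and the argument is at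
most π in absolute value. -/
theorem finite_deckGroup [DiscreteTopology Γ] {C : Set Cover} (hC : IsCompact C) :
    {φ : deckGroup Γ | ∃ p ∈ C, (φ : Cover ≃ₜ Cover) p ∈ C}.Finite := by
  have hmk : Continuous fun q : Cover => (toSL q : PSL2R) := by
    have h : Continuous fun g : SL(2, ℝ) => (g : PSL2R) := continuous_quot_mk
    exact h.comp continuous_toSL
  have hQ : IsCompact ((fun x : Cover × Cover => (toSL x.1 : PSL2R) * (toSL x.2 : PSL2R)⁻¹)
      '' (C ×ˢ C)) :=
    (hC.prod hC).image ((hmk.comp continuous_fst).mul (hmk.comp continuous_snd).inv)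
  have hfin : ({γ : Γ | (γ : PSL2R) ∈ (fun x : Cover × Cover =>
      (toSL x.1 : PSL2R) * (toSL x.2 : PSL2R)⁻¹) '' (C ×ˢ C)}).Finite := by
    have := (Subgroup.tendsto_coe_cofinite_of_discrete Γ
      (isDiscrete_iff_discreteTopology.2 ‹_›)) hQ.compl_mem_cocompact
    rw [mem_map, mem_cofinite] at this
    exact this.subset fun γ hγ => by simpa using hγ
  obtain ⟨B, hB⟩ := (hC.image continuous_snd).isBounded.exists_norm_le
  obtain ⟨N, hN⟩ := exists_nat_gt ((2 * B + 2 * Real.pi) / (2 * Real.pi))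
  choose out hout using fun γ : Γ => QuotientGroup.mk_surjective (γ : PSL2R)
  refine Finite.of_finite_image (f := Subtype.val) (((hfin.prod (finite_Icc (-N : ℤ) N)).image
    fun x : Γ × ℤ => shift (x.2 * (2 * Real.pi)) * lift (out x.1)).subset ?_)
    Subtype.val_injective.injOn
  rintro _ ⟨φ, ⟨p, hp, hφp⟩, rfl⟩
  obtain ⟨γ, hγ, h⟩ := exists_mk_toSL_deck φ.2
  obtain ⟨n, hn⟩ := eq_shift_lift (g := out ⟨γ, hγ⟩) fun q => (h q).trans (by rw [hout])
  refine ⟨(⟨γ, hγ⟩, n), ⟨⟨(_, p), ⟨hφp, hp⟩, ?_⟩, ?_⟩, hn.symm⟩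
  · dsimp only
    rw [h p, mul_inv_cancel_right]
  · have h1 : ((φ : Cover ≃ₜ Cover) p).2
        = p.2 - 2 * Complex.arg (den (out ⟨γ, hγ⟩) p.1) + n * (2 * Real.pi) := by rw [hn]; rfl
    have h2 := abs_le.1 (hB _ (mem_image_of_mem _ hp))
    have h3 := abs_le.1 (hB _ (mem_image_of_mem _ hφp))
    have h4 := abs_le.1 (Complex.abs_arg_le_pi (den (out ⟨γ, hγ⟩) p.1))
    have hpi := Real.pi_pos
    rw [div_lt_iff₀ (by positivity)] at hN
    have h5 : (n : ℝ) < N + 1 := by nlinarith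
    have h6 : -(N + 1 : ℝ) < n := by nlinarith
    constructor
    · have : -((N : ℤ) + 1) < n := by exact_mod_cast h6
      dsimp only; omega
    · have : n < (N : ℤ) + 1 := by exact_mod_cast h5
      dsimp only; omega

/-- M is covered by the increasing open images of a compact exhaustion of ℍ; by compactness one of
them suffices. -/
theorem exists_compact_smul_mem [CompactSpace (QuotientManifold Γ)] :
    ∃ C : Set UpperHalfPlane, IsCompact C ∧
      ∀ p : Cover, ∃ g : SL(2, ℝ), (g : PSL2R) ∈ Γ ∧ g • p.1 ∈ C := by
  let E : CompactExhaustion UpperHalfPlane := default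
  have hsmul : Continuous fun g : SL(2, ℝ) => g • UpperHalfPlane.I := by fun_prop
  let V : ℕ → Set (QuotientManifold Γ) := fun n =>
    (fun g : SL(2, ℝ) => (Quotient.mk (QuotientGroup.rightRel Γ) (g : PSL2R))) ''
      {g | g • UpperHalfPlane.I ∈ interior (E n)}
  have hopen : IsOpenMap fun g : SL(2, ℝ) =>
      (Quotient.mk (QuotientGroup.rightRel Γ) (g : PSL2R)) := by
    have h1 : IsOpenMap fun g : SL(2, ℝ) => (g : PSL2R) := QuotientGroup.isOpenMap_coe
    have h2 : IsOpenMap (Quotient.mk (QuotientGroup.rightRel Γ)) :=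
      isOpenMap_quotient_mk'_mul (Γ := Γ) (T := PSL2R)
    exact h2.comp h1
  have hV : ∀ n, IsOpen (V n) := fun n => hopen _ (isOpen_interior.preimage hsmul)
  have hmono : Monotone V := fun m n hmn => image_mono fun g hg =>
    interior_mono (E.subset hmn) hg
  obtain ⟨n, hn⟩ := isCompact_univ.elim_directed_cover V hV (fun x _ => by
    induction x using Quotient.inductionOn with
    | h γ =>
      obtain ⟨g, rfl⟩ := QuotientGroup.mk_surjective γ
      obtain ⟨n, hn⟩ := mem_iUnion.1 (E.iUnion_eq.symm ▸ mem_univ (g • UpperHalfPlane.I))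
      exact mem_iUnion.2 ⟨n + 1, g, E.subset_interior_succ n hn, rfl⟩) hmono.directed_le
  refine ⟨E n, E.isCompact n, fun p => ?_⟩
  obtain ⟨g, hg, hgp⟩ := hn (mem_univ (proj Γ p))
  have hmem := QuotientGroup.rightRel_apply.1 (Quotient.exact hgp.symm)
  obtain ⟨k, hk⟩ := QuotientGroup.mk_surjective ((g : PSL2R) * (toSL p : PSL2R)⁻¹)
  refine ⟨k, by rw [hk]; exact hmem, ?_⟩
  have e : ((k * toSL p : SL(2, ℝ)) : PSL2R) = (g : PSL2R) := by
    rw [QuotientGroup.mk_mul, hk, inv_mul_cancel_right]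
  have : k • p.1 = g • UpperHalfPlane.I := by
    rw [← toSL_smul_I p, ← mul_smul]
    rcases eq_or_eq_neg_of_mk_eq e with h | h
    · rw [h]
    · rw [h, neg_smul_eq]
  rw [this]
  exact interior_subset hg

theorem exists_isCocompactOn_deckGroup (Γ : Subgroup PSL2R) [DiscreteTopology Γ]
    [CompactSpace (QuotientManifold Γ)] : ∃ K, IsCocompactOn (deckGroup Γ) K := by
  obtain ⟨C, hC, h⟩ := exists_compact_smul_mem (Γ := Γ)
  refine ⟨C ×ˢ Icc 0 (2 * Real.pi), hC.prod isCompact_Icc, fun p => ?_, fun _ => finite_deckGroup⟩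
  obtain ⟨g, hg, hgp⟩ := h p
  have hpi := Real.two_pi_pos
  -- After Γ brings the base point into C, this number of full turns brings the angle into [0, 2π].
  let n : ℤ := -⌊(lift g p).2 / (2 * Real.pi)⌋
  refine ⟨⟨_, mul_mem (shift_mem_deckGroup n) (lift_mem_deckGroup hg)⟩, hgp, ?_⟩
  change (lift g p).2 + (n : ℤ) * (2 * Real.pi) ∈ Icc 0 (2 * Real.pi)
  have h1 := Int.floor_le ((lift g p).2 / (2 * Real.pi))
  have h2 := Int.lt_floor_add_one ((lift g p).2 / (2 * Real.pi))
  rw [le_div_iff₀ hpi] at h1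
  rw [div_lt_iff₀ hpi] at h2
  simp only [n, Int.cast_neg]
  constructor <;> linarith

/-- The deck transformation given by a full turn in the fibre. -/
def fibreTurn (Γ : Subgroup PSL2R) : deckGroup Γ :=
  ⟨shift (2 * Real.pi), by simpa using shift_mem_deckGroup (Γ := Γ) 1⟩

theorem fibreTurn_zpow (n : ℤ) :
    ((fibreTurn Γ ^ n : deckGroup Γ) : Cover ≃ₜ Cover) = shift (n * (2 * Real.pi)) := by
  have hs : ∀ a b : ℝ, shift a * shift b = shift (a + b) := fun a b => by
    ext1 q; exact shift_shift a b q
  induction n using Int.induction_on with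
  | zero => ext1 q; exact Prod.ext rfl (by simp [shift_apply])
  | succ n ih =>
    rw [zpow_add_one, Subgroup.coe_mul, ih, fibreTurn, hs]
    congr 1; push_cast; ring
  | pred n ih =>
    have e : ((fibreTurn Γ)⁻¹ : deckGroup Γ).1 = shift (-(2 * Real.pi)) := by
      rw [Subgroup.coe_inv, fibreTurn, inv_eq_iff_mul_eq_one, hs]
      ext1 q; exact Prod.ext rfl (by simp [shift_apply])
    rw [zpow_sub_one, Subgroup.coe_mul, ih, e, hs]
    congr 1; push_cast; ring

/-- Real homomorphisms of the fundamental group vanish on the fibre: the unit tangent bundle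
of a compact hyperbolic orbifold has nonzero Euler number. -/
theorem map_fibreTurn_eq_zero [DiscreteTopology Γ] [CompactSpace (QuotientManifold Γ)]
    {f : deckGroup Γ → ℝ} (hf : ∀ φ ψ, f (φ * ψ) = f φ + f ψ) : f (fibreTurn Γ) = 0 := by
  obtain ⟨K, h⟩ := exists_isCocompactOn_deckGroup Γ
  have hK := h.isCompact.measurableSet
  have := h.countable
  have hD : ∀ φ : deckGroup Γ, MeasurePreserving (φ : Cover ≃ₜ Cover) volume volume :=
    fun φ => measurePreserving_deck φ.2
  have hshift : ∀ t, IsFlowMap (deckGroup Γ) volume (shift t) := fun t =>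
    ⟨(shift t).continuous, measurePreserving_shift t, fun φ p => shift_deck φ.2 t p⟩
  have hgeo : ∀ s, IsFlowMap (deckGroup Γ) volume (geoFlow s) := fun s =>
    ⟨continuous_geoFlow_apply s, measurePreserving_geoFlow s, fun φ p => geoFlow_deck φ.2 s p⟩
  have hit : ∀ (t : ℝ) (n : ℕ), (shift t)^[n] = shift (n * t) := fun t n => by
    induction n with
    | zero => ext1 q; exact Prod.ext rfl (by simp [shift_apply])
    | succ n ih =>
      ext1 q
      rw [Function.iterate_succ_apply, ih, shift_shift]
      congr 2; push_cast; ring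
  have hturn : ∀ (t : ℝ) (n : ℕ), n * t = 2 * Real.pi →
      n * displacement (deckGroup Γ) K f volume (shift t)
        = displacement (deckGroup Γ) K f volume (shift (2 * Real.pi)) := fun t n ht => by
    rw [← h.displacement_iterate hK hD hf (hshift t), hit, ht]
  have hrel : ∀ (s t : ℝ) (n : ℕ),
      (∀ q, (fun p => geoFlow s (shift t p))^[n] q = shift (2 * Real.pi) q) →
      n * (displacement (deckGroup Γ) K f volume (geoFlow s)
          + displacement (deckGroup Γ) K f volume (shift t))
        = displacement (deckGroup Γ) K f volume (shift (2 * Real.pi)) := fun s t n H => by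
    rw [← h.displacement_comp hK hD hf (hgeo s) (hshift t),
      ← h.displacement_iterate hK hD hf ((hgeo s).comp (hshift t))]
    congr 1
    exact funext H
  -- With A and Z the displacements of the flow and of the full turn, the first relation and the
  -- half turn give A = 0; the second relation and the third of a turn give 4Z/3 = Z.
  have r1 := hrel (Real.log (√2 + 1)) _ 2 (geoFlow_shift_pi_iterate _)
  have r2 := hrel (Real.log (√2 + 1)) _ 4 (geoFlow_shift_squareAngle_iterate _)
  rw [squareAngle_log] at r2
  have t1 := hturn Real.pi 2 (by push_cast; ring)
  have t2 := hturn (2 * Real.pi / 3) 3 (by push_cast; ring)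
  have hz : displacement (deckGroup Γ) K f volume (shift (2 * Real.pi)) = 0 := by
    push_cast at r1 r2 t1 t2
    linarith
  -- The full turn is itself a deck transformation, along which `primitive` grows by the constant f.
  have hfz : displacement (deckGroup Γ) K f volume (shift (2 * Real.pi))
      = f (fibreTurn Γ) * (volume.withDensity (weight (deckGroup Γ) K)).real univ :=
    h.displacement_coe hf (fibreTurn Γ)
  rw [hz] at hfz
  refine (mul_eq_zero.1 hfz.symm).resolve_right ?_
  exact (ENNReal.toReal_ne_zero.2 ⟨h.withDensity_univ_ne_zero hK hD volume_cover_ne_zero,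
    ((h.withDensity_univ_le hK).trans_lt h.isCompact.measure_lt_top).ne⟩)

end Deck

/-- An element on which all real homomorphisms vanish has a power which is a product of
commutators. -/
theorem exists_pow_mem_commutator {G : Type*} [Group G] {z : G}
    (h : ∀ f : G → ℝ, (∀ a b, f (a * b) = f a + f b) → f z = 0) :
    ∃ m : ℕ, 0 < m ∧ z ^ m ∈ _root_.commutator G := by
  by_contra! H
  let x : Additive (Abelianization G) := Additive.ofMul (Abelianization.of z)
  have hinj : Function.Injective (zmultiplesHom (Additive (Abelianization G)) x) := by
    have h0 : ¬ IsOfFinAddOrder x := fun hx => by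
      obtain ⟨m, hm, e⟩ := isOfFinAddOrder_iff_nsmul_eq_zero.1 hx
      refine H m hm ?_
      rw [← Abelianization.ker_of, MonoidHom.mem_ker, map_pow]
      exact e
    exact injective_zsmul_iff_not_isOfFinAddOrder.2 h0
  -- If z had infinite order in the abelianization, the homomorphism sending it to 1 would extend to
  -- all of it, ℝ being divisible and hence injective.
  obtain ⟨F, hF⟩ := (Module.Baer.of_divisible ℝ).extension_property_addMonoidHom _ hinj
    (zmultiplesHom ℝ (1 : ℝ))
  have h1 : F x = 1 := by
    have := DFunLike.congr_fun hF 1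
    simpa using this
  have h2 := h (fun a => F (Additive.ofMul (Abelianization.of a))) fun a b => by
    rw [map_mul, ofMul_mul, map_add]
  exact one_ne_zero (h1.symm.trans h2)

theorem exists_shift_mem_commutator (Γ : Subgroup PSL2R) [DiscreteTopology Γ]
    [CompactSpace (QuotientManifold Γ)] :
    ∃ m : ℕ, 0 < m ∧ shift (-(m * (2 * Real.pi))) ∈ ⁅deckGroup Γ, deckGroup Γ⁆ := by
  obtain ⟨m, hm, h⟩ := exists_pow_mem_commutator (z := fibreTurn Γ) fun _ => map_fibreTurn_eq_zero
  refine ⟨m, hm, ?_⟩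
  rw [← Subgroup.map_subtype_commutator]
  -- The negative power is the one that closes up the backward curve `fibreCurve`.
  refine ⟨(fibreTurn Γ ^ (-m : ℤ)), ?_, ?_⟩
  · rw [zpow_neg, zpow_natCast]
    exact inv_mem h
  · rw [Subgroup.coe_subtype, fibreTurn_zpow]
    congr 1; push_cast; ring

/-- L + 1/2 is half of a sum of squares, so the bound holds for every curve, closed or not. -/
theorem action_nonneg {γ : ℝ → Cover} {T k : ℝ} (hT : 0 ≤ T) (hk : 1 / 2 ≤ k) :
    0 ≤ action k γ T := by
  unfold action
  split_ifs
  · refine EReal.coe_nonneg.2 (intervalIntegral.integral_nonneg hT fun t _ => ?_)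
    have hy := (γ t).1.im_pos
    set v := velocity γ t
    have e : lagrangian (γ t) v + k = 1 / 2 * ((v.1 / (γ t).1.im) ^ 2 + (v.2.1 / (γ t).1.im) ^ 2
        + (v.2.2 + v.1 / (γ t).1.im + 1) ^ 2) + (k - 1 / 2) := by
      unfold lagrangian
      field_simp
      ring
    rw [e]
    have : 0 ≤ k - 1 / 2 := by linarith
    positivity
  · exact le_top

/-- Going backwards along the fibre. -/
def fibreCurve (t : ℝ) : Cover := (UpperHalfPlane.I, -t)

theorem isC1Curve_fibreCurve : IsC1Curve fibreCurve :=
  ⟨contDiff_const, contDiff_const, contDiff_neg⟩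

theorem lagrangian_fibreCurve (t : ℝ) :
    lagrangian (fibreCurve t) (velocity fibreCurve t) = -1 / 2 := by
  have e : velocity fibreCurve t = (0, 0, -1) := by simp [velocity, fibreCurve]
  rw [e]
  norm_num [lagrangian, fibreCurve]

/-- The backward fibre run m times closes up in the abelian cover and has action (k - 1/2) · 2πm,
which is negative for k < 1/2. -/
theorem cAbelian_eq (Γ : Subgroup PSL2R) [DiscreteTopology Γ]
    [CompactSpace (QuotientManifold Γ)] : cAbelian Γ = 1 / 2 := by
  refine criticalValue_eq (fun k hk T γ hT _ _ => action_nonneg hT.le hk) fun k hk => ?_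
  obtain ⟨m, hm, h⟩ := exists_shift_mem_commutator Γ
  have hpi := Real.pi_pos
  have hT : 0 < m * (2 * Real.pi) := by positivity
  refine ⟨m * (2 * Real.pi), fibreCurve, hT, isC1Curve_fibreCurve.isACCurve _,
    ⟨_, h, Prod.ext rfl (by simp [shift_apply, fibreCurve])⟩, ?_⟩
  rw [action_eq k (isC1Curve_fibreCurve.continuous_lagrangian.intervalIntegrable _ _)]
  simp only [lagrangian_fibreCurve, intervalIntegral.integral_const, smul_eq_mul]
  rw [← EReal.coe_zero, EReal.coe_lt_coe_iff]
  nlinarith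

end

end MagneticPSL

theorem mainTheorem6 (Γ : Subgroup PSL2R) (hdiscrete : DiscreteTopology Γ)
    (hcocompact : CompactSpace (QuotientManifold Γ)) :
    -- the Lagrangian is invariant under deck transformations, so that it descends to `M`
    (∀ φ ∈ deckGroup Γ, ∀ (γ : ℝ → Cover) (t : ℝ), CurveDifferentiableAt γ t →
      CurveDifferentiableAt (fun s => φ (γ s)) t ∧
        lagrangian (φ (γ t)) (velocity (fun s => φ (γ s)) t)
          = lagrangian (γ t) (velocity γ t)) ∧
    cUniversal = 1 / 4 ∧ cAbelian Γ = 1 / 2 ∧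
    (∀ p : Cover, peierlsBarrier p p = (Real.pi : EReal)) ∧
    (∀ p q : Cover, peierlsBarrier p q ≠ ⊤ ∧ peierlsBarrier p q ≠ ⊥) ∧
    aubrySet = ∅ :=
  ⟨fun _ hφ _ _ h => lagrangian_deck hφ h, cUniversal_eq, cAbelian_eq Γ, peierlsBarrier_self,
    peierlsBarrier_finite, aubrySet_eq_empty⟩
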